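/- **Setting.** Let $E$ be a (nonempty) standard Borel space and $K$ a probability kernel from $E^2$ to $E$. The parents of a site $(i,j)\in\mathbb Z^2$ are $(i-1,j)$ and $(i,j-1)$; the internal boundary $\partial_I S$ of $S\subset\mathbb Z^2$ is the set of sites of $S$ with at least one parent outside $S$. For boundary conditions $\mathbf x$ on $\{(i,0),(0,i):i\ge 1\}$, the unilateral field $\mathbf X^{\mathbf x}$ on $\{1,2,\dots\}^2$ has in every box $\{1,\dots,m\}\times\{1,\dots,n\}$ the law $\prod_{i\le m,\,j\le n}K(dx_{i,j}\mid x_{i-1,j},x_{i,j-1})$. The kernel $K$ is *uniformly ergodic* if there is a stationary field $\mathbf X'$ (extended to $\mathbb Z^2$; the *equilibrium field*) such that for every box $\Lambda_{m,n}=\{1,\dots,m\}\times\{1,\dots,n\}$ the total variation distance between the laws of $\mathbf X^{\mathbf x}_{(a,b)+\Lambda_{m,n}}$ and $\mathbf X'_{\Lambda_{m,n}}$ tends to $0$ as $a,b\to\infty$, uniformly in $\mathbf x$. **Blocks.** Let $d\ge 2$, $l\ge 1$ be integers, $\mathcal V_d=\{(h,k)\in\mathbb Z^2: h+k\equiv 0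 \bmod (d-1)\}$, and for $(h,k)\in\mathcal V_d$ let $$B_{h,k}=\{(1,l),(2,l-1),\dots,(l,1)\}+(hl,kl),$$ $$R_{h,k}=\{(i,j): i\le l(h+1),\ j\le l(k+1),\ (h+k-d+2)l+2\le i+j\le (h+k+1)l+1\}\supset B_{h,k}.$$ In the graph $\mathcal G_d$ on $\mathcal V_d$ the $d$ parents of $(h,k)$ are $(h-i,k+i-d+1)$, $i=0,\dots,d-1$; the union of their blocks is the set $\overrightarrow{\partial}R_{h,k}$ of parents of sites of $R_{h,k}$ lying outside $R_{h,k}$. **Block coupling.** Let $s_m:(0,1)\times E^2\to E$, $0\le m<(d-1)l$, be (jointly) measurable functions such that $s_m(U;x,y)\sim K(\cdot\mid x,y)$ for all $x,y\in E$ when $U$ is uniform on $(0,1)$. For a configuration $\mathbf u\in(0,1)^{\mathbb Z^2}$, a finite $S\subset\mathbb Z^2$ and boundary values $\mathbf x$ off $S$, construct a field on $S$ by the recursion $$X^{\mathbf x}_{i,j}=s_{m(i,j)}(u_{i,j};X^{\mathbf x}_{i-1,j},X^{\mathbf x}_{i,j-1}),\qquad m(i,j)=i+j-l-1 \bmod (d-1)l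 .$$ For $S=R_{h,k}$ write $F(\mathbf u_{R_{h,k}};\mathbf x)$ for the resulting values on $B_{h,k}$. Suppose that there are measurable functions $\psi$ (with values in $\{0,1\}$) and $\Phi$ of $\mathbf u_{R_{h,k}}$ (the same for all $(h,k)$, up to translation) such that, with $W_{h,k}=\psi(\mathbf u_{R_{h,k}})$: * if $\mathbf U$ is a field of independent uniform variables on $(0,1)$, then $P(W_{h,k}=0)>\frac{d-1}{d}$; * if $W_{h,k}=0$, then $F(\mathbf u_{R_{h,k}};\mathbf x)=\Phi(\mathbf u_{R_{h,k}})$ for all $\mathbf x\in E^{\overrightarrow{\partial}R_{h,k}}$. **The random region.** Call a finite $\Lambda\subset\mathbb Z^2$ *admissible* if $\partial_I\Lambda$ is a union of blocks $B_{h,k}$, $(h,k)\in\mathcal V_d$. Let $\sigma(\Lambda)$ be the set of vertices of $\mathcal V_d$ from which there is an increasing path $\gamma_0,\dots,\gamma_n$ of length $n\ge1$ in $\mathcal G_d$ (each $\gamma_k$ is a parent of $\gamma_{k+1}$) that ends at a block of $\partial_I\Lambda$ and is open, that is, $W_{\gamma_k}=1$ for $k=1,\dots,n$. Put $D(\Lambda)=\Lambda\cup\bigcup_{v\in\sigma(\Lambda)}B_v$,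 and let $D^+(\Lambda)$ be the union of $D(\Lambda)$ and of the regions $R_v$ over all $v\in\sigma(\Lambda)$ and all blocks $B_v\subset\partial_I\Lambda$. For finite $B\subset \mathbb Z^2$ let $\Upsilon^B(\mathbf u_B)$ be the configuration on $B$ obtained by putting the value $\Phi(\mathbf u_{R_v})$ on each block $B_v$ with $R_v\subset B$ and $W_v=0$, and by using the recursion above (with an arbitrary fixed value off $B$) at the other sites of $B$. **Theorem.** Under these assumptions $K$ is uniformly ergodic. Every finite $\Lambda\subset\mathbb Z^2$ is contained in an admissible one. If $\mathbf U$ is a field of independent uniform variables on $(0,1)$ indexed by $\mathbb Z^2$, then for every admissible $\Lambda$ the region $D^+(\Lambda)$ is almost surely finite, and the equilibrium field restricted to $\Lambda$ has the law of the restriction to $\Lambda$ of $\Upsilon^{D^+(\Lambda)}(\mathbf U_{D^+(\Lambda)})$. Moreover there is a constant $C$, not depending on $\Lambda$, such that for every admissible $\Lambda$ $$\bigl|\,\mathbb E|D(\Lambda)|-|\Lambda|\,\bigr|\le C\,|\partial_I\Lambda|\qquad\text{and}\qquad \bigl|\,\mathbb E|D^+(\Lambda)|-|\Lambda|\,\bigr|\le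 C\,|\partial_I\Lambda| .$$ -/

import Mathlib

open MeasureTheory ProbabilityTheory Filter Topology

/-- The open unit interval `(0,1)`, in which the uniform variables take their values. -/
abbrev UnitIoo : Type := Set.Ioo (0 : ℝ) 1

/-- The uniform distribution on `(0,1)`. -/
noncomputable def uniformLaw : Measure UnitIoo := (volume : Measure ℝ).comap Subtype.val

instance : IsProbabilityMeasure uniformLaw := by
  constructor
  rw [uniformLaw, (MeasurableEmbedding.subtype_coe measurableSet_Ioo).comap_apply,
    Set.image_univ, Subtype.range_coe, Real.volume_Ioo]
  norm_num

/-- The sites of the lattice `ℤ²`. The parents of `p` are `p - (1,0)` and `p - (0,1)`. -/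
abbrev Site : Type := ℤ × ℤ

/-! ### The unilateral field with kernel `K` and uniform ergodicity -/

section Ergodicity

variable {E : Type*} [MeasurableSpace E]

/-- One step of the sequential simulation: the value at the site `p` is drawn from `K` given the
values at the two parents of `p`; all the other values are kept. -/
noncomputable def siteKernel (K : Kernel (E × E) E) (p : Site) :
    Kernel (Site → E) (Site → E) :=
  ((Kernel.id : Kernel (Site → E) (Site → E)) ×ₖ
    (K.comap (fun c : Site → E => (c (p - (1, 0)), c (p - (0, 1)))) (by fun_prop))).map
      (fun q => Function.update q.1 p q.2)

/-- The sites of `{1,…,M} × {1,…,N}`, listed row by row, so that each site comes after its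
parents. -/
def boxList (M N : ℕ) : List Site :=
  (List.range N).flatMap fun j => (List.range M).map fun i => ((i : ℤ) + 1, (j : ℤ) + 1)

/-- The law of the unilateral field with kernel `K` on `{1,…,M} × {1,…,N}` with boundary
conditions `x`, that is, `∏ K(dx_{i,j} | x_{i-1,j}, x_{i,j-1})` along an increasing order of the
sites. It is a law on the configurations on `ℤ²`, which are left equal to `x` off the box. On the
box, only the values of `x` at the sites `(i,0)` and `(0,j)` with `i, j ≥ 1` matter. -/
noncomputable def boxLaw (K : Kernel (E × E) E) (x : Site → E) (M N : ℕ) :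
    Measure (Site → E) :=
  (boxList M N).foldl (fun μ p => μ.bind (siteKernel K p)) (Measure.dirac x)

/-- The finite box `{1,…,m} × {1,…,n}`. -/
noncomputable def box (m n : ℕ) : Finset Site := Finset.Icc 1 (m : ℤ) ×ˢ Finset.Icc 1 (n : ℤ)

/-- The part of a configuration in the translate by `t` of the finite set `S`. -/
def window (S : Finset Site) (t : Site) (c : Site → E) : S → E := fun p => c (p + t)

/-- Total variation distance `sup_A |μ(A) - ν(A)|` of two probability measures. -/
noncomputable def tvDist {α : Type*} [MeasurableSpace α] (μ ν : Measure α) : ENNReal :=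
  ⨆ (A : Set α) (_ : MeasurableSet A), ENNReal.ofReal |μ.real A - ν.real A|

/-- The distance of the law of the field with boundary conditions `x` in
`t + {1,…,m} × {1,…,n}` from the law of the field `π` in `{1,…,m} × {1,…,n}`. -/
noncomputable def distToField (K : Kernel (E × E) E) (π : Measure (Site → E)) (m n : ℕ)
    (x : Site → E) (t : ℕ × ℕ) : ENNReal :=
  tvDist ((boxLaw K x (t.1 + m) (t.2 + n)).map (window (box m n) ((t.1 : ℤ), (t.2 : ℤ))))
    (π.map (window (box m n) 0))

/-- `π` is the law of the equilibrium field of `K` (extended to `ℤ²`): it is stationary, and the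
fields with kernel `K` started from any boundary conditions approach it, in total variation in
boxes of any fixed size, as the boxes move away from both boundaries. -/
structure IsEquilibriumField (K : Kernel (E × E) E) (π : Measure (Site → E)) : Prop where
  isProbabilityMeasure : IsProbabilityMeasure π
  stationary : ∀ t : Site, π.map (fun c p => c (p + t)) = π
  tendsto : ∀ (x : Site → E) (m n : ℕ), Tendsto (distToField K π m n x) atTop (𝓝 0)

/-- Uniform ergodicity: there is an equilibrium field, and the convergence to it is uniform in the
boundary conditions. -/
def UniformlyErgodic (K : Kernel (E × E) E) : Prop :=
  ∃ π : Measure (Site → E), IsEquilibriumField K π ∧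
    ∀ m n : ℕ, Tendsto (fun t : ℕ × ℕ => ⨆ x : Site → E, distToField K π m n x t) atTop (𝓝 0)

end Ergodicity

/-! ### Blocks, trapezoids, the graph of blocks and open paths -/

/-- The internal boundary: the sites of `S` with at least one parent outside `S`. -/
def internalBoundary (S : Finset Site) : Finset Site :=
  S.filter fun p => p - (1, 0) ∉ S ∨ p - (0, 1) ∉ S

/-- The vertices of the graph of blocks: pairs `(h,k)` with `h + k ≡ 0 mod (d-1)`. -/
def blockVertices (d : ℕ) : Set Site := {v | ((d : ℤ) - 1) ∣ v.1 + v.2}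

/-- The block `B_{h,k} = {(1,l), (2,l-1), …, (l,1)} + (hl, kl)`, where `v = (h,k)`. -/
noncomputable def block (l : ℕ) (v : Site) : Finset Site :=
  (Finset.Icc 1 (l : ℤ)).image fun a => (v.1 * l + a, v.2 * l + (l + 1 - a))

/-- The trapezoid `R_{h,k}`, where `v = (h,k)`; see `mem_trapezoid`. -/
noncomputable def trapezoid (d l : ℕ) (v : Site) : Finset Site :=
  (Finset.Icc ((v.1 - d + 1) * l + 2) (l * (v.1 + 1)) ×ˢ
    Finset.Icc ((v.2 - d + 1) * l + 2) (l * (v.2 + 1))).filter fun p =>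
      (v.1 + v.2 - d + 2) * l + 2 ≤ p.1 + p.2 ∧ p.1 + p.2 ≤ (v.1 + v.2 + 1) * l + 1

theorem mem_trapezoid (d l : ℕ) (v p : Site) :
    p ∈ trapezoid d l v ↔ p.1 ≤ l * (v.1 + 1) ∧ p.2 ≤ l * (v.2 + 1) ∧
      (v.1 + v.2 - d + 2) * l + 2 ≤ p.1 + p.2 ∧ p.1 + p.2 ≤ (v.1 + v.2 + 1) * l + 1 := by
  simp only [trapezoid, Finset.mem_filter, Finset.mem_product, Finset.mem_Icc]
  constructor
  · rintro ⟨⟨⟨_, h1⟩, _, h2⟩, h3, h4⟩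
    exact ⟨h1, h2, h3, h4⟩
  · rintro ⟨h1, h2, h3, h4⟩
    exact ⟨⟨⟨by linarith, h1⟩, by linarith, h2⟩, h3, h4⟩

/-- `v` is one of the `d` parents `(h-i, k+i-(d-1))`, `i = 0,…,d-1`, of the vertex `w = (h,k)` in
the graph of blocks. -/
def IsBlockParent (d : ℕ) (v w : Site) : Prop :=
  ∃ i : ℕ, i < d ∧ v = (w.1 - i, w.2 + i - ((d : ℤ) - 1))

/-- The blocks contained in the internal boundary of `Λ`. -/
def boundaryBlocks (d l : ℕ) (Λ : Finset Site) : Set Site :=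
  {v | v ∈ blockVertices d ∧ block l v ⊆ internalBoundary Λ}

/-- The internal boundary of `Λ` is a union of blocks. -/
def BoundaryIsBlocks (d l : ℕ) (Λ : Finset Site) : Prop :=
  ∀ p ∈ internalBoundary Λ, ∃ v ∈ boundaryBlocks d l Λ, p ∈ block l v

/-- The values of `u` in the trapezoid `R_v`, viewed as a function on `R_{0,0}` by translation. -/
def onTrapezoid (d l : ℕ) (u : Site → UnitIoo) (v : Site) : trapezoid d l 0 → UnitIoo :=
  fun r => u (r + (v.1 * l, v.2 * l))

/-- The binary field `W_v = ψ(u_{R_v})`. -/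
def binaryField (d l : ℕ) (ψ : (trapezoid d l 0 → UnitIoo) → Fin 2) (u : Site → UnitIoo)
    (v : Site) : Fin 2 :=
  ψ (onTrapezoid d l u v)

/-- `σ(Λ)`: the vertices that are joined to a boundary block of `Λ` by an open increasing path
`γ 0, …, γ n` of length `n > 0` in the graph of blocks, a path being open when `W = 1` at all its
vertices but possibly the first one. -/
def sigmaSet (d l : ℕ) (W : Site → Fin 2) (Λ : Finset Site) : Set Site :=
  {v | ∃ (n : ℕ) (γ : ℕ → Site), 0 < n ∧ γ 0 = v ∧ γ n ∈ boundaryBlocks d l Λ ∧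
    ∀ k < n, IsBlockParent d (γ k) (γ (k + 1)) ∧ W (γ (k + 1)) = 1}

/-- `D(Λ) = Λ ∪ σ(Λ)`, as a set of sites. -/
def regionD (d l : ℕ) (W : Site → Fin 2) (Λ : Finset Site) : Set Site :=
  (Λ : Set Site) ∪ ⋃ v ∈ sigmaSet d l W Λ, (block l v : Set Site)

/-- `D(Λ)` together with the trapezoids `R_v` of its blocks (those of `∂_I Λ` and of `σ(Λ)`): the
sites whose uniform variables are used to construct the field on `Λ`. -/
def regionDPlus (d l : ℕ) (W : Site → Fin 2) (Λ : Finset Site) : Set Site :=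
  regionD d l W Λ ∪
    ⋃ v ∈ boundaryBlocks d l Λ ∪ sigmaSet d l W Λ, (trapezoid d l v : Set Site)

/-! ### Coupling functions and the constructed fields -/

section Coupling

variable {E : Type*}

/-- Recursion over the finite region `S` along increasing orders: the values off `S` are given by
`x`, and the value at `p ∈ S` is `step p` of the values at the parents of `p`. -/
def evolve (S : Finset Site) (step : Site → E → E → E) (x : Site → E) (p : Site) : E :=
  if p ∈ S then
    step p (evolve S step x (p - (1, 0))) (evolve S step x (p - (0, 1)))
  else x p
termination_by (S.filter (· ≤ p)).card
decreasing_by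
  all_goals
    rename_i hp
    apply Finset.card_lt_card
    rw [Finset.ssubset_iff_of_subset]
    · refine ⟨p, by simp [hp], ?_⟩
      simp [Prod.le_def]
    · intro q hq
      simp only [Finset.mem_filter, Prod.le_def, Prod.fst_sub, Prod.snd_sub] at hq ⊢
      exact ⟨hq.1, by linarith [hq.2.1], by linarith [hq.2.2]⟩

theorem evolve_congr {E : Type*} {S : Finset Site} {f g : Site → E → E → E} {x : Site → E}
    (h : ∀ p ∈ S, f p = g p) (p : Site) : evolve S f x p = evolve S g x p := by
  induction hn : (S.filter (· ≤ p)).card using Nat.strong_induction_on generalizing p with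
  | _ n ih =>
  by_cases hp : p ∈ S
  · rw [evolve, evolve.eq_1 S g, if_pos hp, if_pos hp, h p hp]
    have key : ∀ e : Site, 0 ≤ e → e ≠ 0 → (S.filter (· ≤ p - e)).card < n := by
      intro e he he0
      rw [← hn]
      apply Finset.card_lt_card
      rw [Finset.ssubset_iff_of_subset]
      · refine ⟨p, by simp [hp], ?_⟩
        simp only [Finset.mem_filter, not_and]
        intro _ h2
        have : e ≤ 0 := by simpa using h2
        exact he0 (le_antisymm this he)
      · intro q hq
        simp only [Finset.mem_filter] at hq ⊢
        exact ⟨hq.1, hq.2.trans (by simpa using he)⟩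
    rw [ih _ (key (1,0) (by decide) (by decide)) _ rfl, ih _ (key (0,1) (by decide) (by decide)) _ rfl]
  · rw [evolve, evolve.eq_1 S g, if_neg hp, if_neg hp]

/-- `m(i,j) = i + j - l - 1 mod (d-1)l`. -/
def diagIndex (d l : ℕ) (p : Site) : ℕ := ((p.1 + p.2 - l - 1) % (((d : ℤ) - 1) * l)).toNat

/-- The field on the finite region `S` with boundary conditions `x` constructed from `u` by
`X_{i,j} = s_{m(i,j)}(u_{i,j}; X_{i-1,j}, X_{i,j-1})`. -/
def coupledField (d l : ℕ) (s : ℕ → UnitIoo → E → E → E) (S : Finset Site)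
    (u : Site → UnitIoo) (x : Site → E) : Site → E :=
  evolve S (fun p => s (diagIndex d l p) (u p)) x

/-- The coupling functions `s_m`, `0 ≤ m < (d-1)l`, the binary function `ψ` and the function `Φ`
satisfy: each `s_m` is measurable and realizes a coupling of the laws `K(·|x,y)`; the binary field
has `P(W = 0) > (d-1)/d`; and `W = 0` forces the block to take the value `Φ`, whatever the values
on the parent blocks are. -/
structure IsBlockCoupling [MeasurableSpace E] (K : Kernel (E × E) E) (d l : ℕ)
    (s : ℕ → UnitIoo → E → E → E) (ψ : (trapezoid d l 0 → UnitIoo) → Fin 2)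
    (Φ : (trapezoid d l 0 → UnitIoo) → block l 0 → E) : Prop where
  measurable_s : ∀ m < (d - 1) * l, Measurable fun q : UnitIoo × E × E => s m q.1 q.2.1 q.2.2
  map_s : ∀ m < (d - 1) * l, ∀ x y : E,
    uniformLaw.map (fun u => s m u x y) = K (x, y)
  measurable_ψ : Measurable ψ
  measurable_Φ : Measurable Φ
  prob_zero : ((d : ℝ) - 1) / d <
    (Measure.pi fun _ : trapezoid d l 0 => uniformLaw).real {w | ψ w = 0}
  eq_of_zero : ∀ (u : Site → UnitIoo), ψ ((trapezoid d l 0).restrict u) = 0 →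
    ∀ (x : Site → E) (p : block l 0),
      coupledField d l s (trapezoid d l 0) u x p = Φ ((trapezoid d l 0).restrict u) p

/-- The only possible index of a block containing `p`. -/
def blockIndex (l : ℕ) (p : Site) : Site := ((p.1 - 1) / l, (p.2 - 1) / l)

open Classical in
/-- The map `Υ^B`. The values in the blocks `B_v` with `R_v ⊆ B` and `W_v = 0` are read off from
`Φ(u_{R_v})`; at the other sites of `B` the recursion with the coupling functions is used. Only the
values of `u` on `B` enter. Off `B`, and where the recursion has to look off `B`, the value is
irrelevant. -/
noncomputable def upsilon [Nonempty E] (d l : ℕ) (s : ℕ → UnitIoo → E → E → E)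
    (ψ : (trapezoid d l 0 → UnitIoo) → Fin 2)
    (Φ : (trapezoid d l 0 → UnitIoo) → block l 0 → E)
    (B : Finset Site) (u : Site → UnitIoo) : Site → E :=
  evolve B
    (fun p a b =>
      let v := blockIndex l p
      if h : p - (v.1 * l, v.2 * l) ∈ block l 0 then
        if v ∈ blockVertices d ∧ trapezoid d l v ⊆ B ∧ binaryField d l ψ u v = 0 then
          Φ (onTrapezoid d l u v) ⟨_, h⟩
        else s (diagIndex d l p) (u p) a b
      else s (diagIndex d l p) (u p) a b)
    (fun _ => Classical.arbitrary E)

/-- `Υ^B(u)` depends on the restriction of `u` to `B` only. -/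
theorem upsilon_congr {E : Type*} [Nonempty E] (d l : ℕ) (s : ℕ → UnitIoo → E → E → E)
    (ψ : (trapezoid d l 0 → UnitIoo) → Fin 2)
    (Φ : (trapezoid d l 0 → UnitIoo) → block l 0 → E)
    (B : Finset Site) (u u' : Site → UnitIoo) (h : ∀ p ∈ B, u p = u' p) :
    upsilon d l s ψ Φ B u = upsilon d l s ψ Φ B u' := by
  funext p
  refine evolve_congr (fun q hq => ?_) p
  funext a b
  have key : ∀ v, trapezoid d l v ⊆ B → onTrapezoid d l u v = onTrapezoid d l u' v := by
    intro v hv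
    funext r
    apply h; apply hv
    have := (mem_trapezoid d l 0 r).1 r.2
    rw [mem_trapezoid]
    simp at this ⊢
    refine ⟨by linarith, by linarith, by linarith, by linarith⟩
  dsimp only
  split_ifs with h1 h2 h3 h3
  · rw [key _ h2.2.1]
  · exact absurd ⟨h2.1, h2.2.1, by rw [binaryField, ← key _ h2.2.1]; exact h2.2.2⟩ h3
  · exact absurd ⟨h3.1, h3.2.1, by rw [binaryField, key _ h3.2.1]; exact h3.2.2⟩ h2
  · rw [h q hq]
  · rw [h q hq]

open Classical in
/-- The configuration on `Λ` given by `Υ` on the random region determined by the binary field, when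
this region is finite. -/
noncomputable def perfectSample [Nonempty E] (d l : ℕ) (s : ℕ → UnitIoo → E → E → E)
    (ψ : (trapezoid d l 0 → UnitIoo) → Fin 2)
    (Φ : (trapezoid d l 0 → UnitIoo) → block l 0 → E)
    (Λ : Finset Site) (u : Site → UnitIoo) : Λ → E := fun p =>
  if h : (regionDPlus d l (binaryField d l ψ u) Λ).Finite then
    upsilon d l s ψ Φ h.toFinset u p
  else Classical.arbitrary E

end Coupling

/-! ### Combinatorics of blocks and trapezoids -/

/-! The argument is a coupling from the past. Fields with all boundary conditions are built from the
same uniform variables, and one looks backwards from `Λ`. Away from `∂_I Λ` the recursion stays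
inside `Λ`, so only the boundary blocks need outside information. A block with `W = 0` needs nothing
beyond the uniforms of its trapezoid; a block with `W = 1` is computed through its trapezoid from
the blocks of its `d` parents. The blocks ever needed are therefore those of `∂_I Λ` and of `σ(Λ)`,
and any region containing `D⁺(Λ)` produces on `Λ` the values of `Υ`, whatever the boundary
conditions (`IsBlockCoupling.coupledField_eq_upsilon`).

The search is subcritical. Along a path in the graph of blocks the trapezoids lie at different
levels and are disjoint, so `n` prescribed vertices of it are all open with probability `q ^ n`,
where `q = P(W = 1) < 1/d` (`uniformField_open_path`). Each boundary block starts `d ^ n` backward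
paths of length `n`, so the expected size of `σ(Λ)` is at most the number of boundary blocks times
`∑ (d q) ^ n` (`lintegral_encard_sigmaSet_le`). This gives both the almost sure finiteness of
`D⁺(Λ)` and the bounds on expected sizes.

For ergodicity, the perfect samples on different admissible regions agree almost surely and define
one random field `X` (`IsBlockCoupling.exists_field`). The total variation distance between the
unilateral field and `X` in a window is at most the probability that `D⁺(Λ)` crosses the lower or
left boundary, a bound free of the boundary conditions that tends to `0`
(`IsBlockCoupling.distToField_le`). Stationarity and uniqueness of the equilibrium field follow from
uniqueness of limits. -/

theorem mem_block_iff {l : ℕ} {v p : Site} :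
    p ∈ block l v ↔ v.1 * l + 1 ≤ p.1 ∧ p.1 ≤ v.1 * l + l ∧
      p.1 + p.2 = (v.1 + v.2 + 1) * l + 1 := by
  simp only [block, Finset.mem_image, Finset.mem_Icc]
  constructor
  · rintro ⟨a, ⟨h1, h2⟩, rfl⟩
    exact ⟨by dsimp only; linarith, by dsimp only; linarith, by dsimp only; ring⟩
  · rintro ⟨h1, h2, h3⟩
    refine ⟨p.1 - v.1 * l, ⟨by linarith, by linarith⟩, Prod.ext ?_ ?_⟩ <;> dsimp only <;> linarith

theorem int_ediv_eq_of_bounds {l : ℕ} (hl : 1 ≤ l) {a b : ℤ} (h1 : a * l ≤ b)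
    (h2 : b < a * l + l) : b / l = a := by
  have hl' : (0 : ℤ) < l := by exact_mod_cast hl
  exact Int.le_antisymm (Int.lt_add_one_iff.1 (Int.ediv_lt_of_lt_mul hl' (by linarith)))
    ((Int.le_ediv_iff_mul_le hl').2 h1)

theorem blockIndex_eq_of_mem {l : ℕ} (hl : 1 ≤ l) {v p : Site} (hp : p ∈ block l v) :
    blockIndex l p = v := by
  obtain ⟨h1, h2, h3⟩ := mem_block_iff.1 hp
  exact Prod.ext (int_ediv_eq_of_bounds hl (by linarith) (by linarith))
    (int_ediv_eq_of_bounds hl (by linarith) (by linarith))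

theorem sub_mem_block_zero_iff {l : ℕ} {v p : Site} :
    p - (v.1 * l, v.2 * l) ∈ block l 0 ↔ p ∈ block l v := by
  simp only [mem_block_iff, Prod.fst_sub, Prod.snd_sub, Prod.fst_zero, Prod.snd_zero]
  constructor <;> rintro ⟨h1, h2, h3⟩ <;> exact ⟨by linarith, by linarith, by linarith⟩

theorem mem_trapezoid_zero_iff {d l : ℕ} {v p : Site} :
    p ∈ trapezoid d l 0 ↔ p + (v.1 * l, v.2 * l) ∈ trapezoid d l v := by
  simp only [mem_trapezoid, Prod.fst_add, Prod.snd_add, Prod.fst_zero, Prod.snd_zero]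
  constructor <;> rintro ⟨h1, h2, h3, h4⟩ <;>
    exact ⟨by linarith, by linarith, by linarith, by linarith⟩

/-- The blocks with `h + k = n` tile a whole diagonal, and the first coordinate selects the tile.
Here `n` need not be a multiple of `d - 1`. -/
theorem mem_block_of_add_eq {l : ℕ} (hl : 1 ≤ l) {p : Site} {n : ℤ}
    (hp : p.1 + p.2 = (n + 1) * l + 1) :
    p ∈ block l ((p.1 - 1) / l, n - (p.1 - 1) / l) := by
  have hl' : (0 : ℤ) < l := by exact_mod_cast hl
  have h1 := Int.emod_nonneg (p.1 - 1) hl'.ne'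
  have h2 := Int.emod_lt_of_pos (p.1 - 1) hl'
  have h3 := Int.mul_ediv_add_emod (p.1 - 1) l
  rw [mem_block_iff]
  refine ⟨?_, ?_, ?_⟩
  · dsimp only; linarith
  · dsimp only; linarith
  · dsimp only; rw [hp]; ring

theorem block_subset_trapezoid {d l : ℕ} (hd : 2 ≤ d) (hl : 1 ≤ l) (v : Site) :
    block l v ⊆ trapezoid d l v := by
  intro p hp
  obtain ⟨h1, h2, h3⟩ := mem_block_iff.1 hp
  have hl' : (1 : ℤ) ≤ l := by exact_mod_cast hl
  have hd' : (2 : ℤ) ≤ d := by exact_mod_cast hd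
  rw [mem_trapezoid]
  exact ⟨by linarith, by linarith, by nlinarith, by linarith⟩

/-- The parents of a vertex of the graph of blocks are vertices. -/
theorem IsBlockParent.mem_blockVertices {d : ℕ} {v w : Site} (h : IsBlockParent d v w)
    (hw : w ∈ blockVertices d) : v ∈ blockVertices d := by
  obtain ⟨i, _, rfl⟩ := h
  obtain ⟨c, hc⟩ : ((d : ℤ) - 1) ∣ w.1 + w.2 := hw
  exact ⟨c - 1, by dsimp only; linear_combination hc⟩

/-- A site just below the trapezoid `R_v` is in a block of a parent of `v`. -/
theorem exists_parent_block {d l : ℕ} (hl : 1 ≤ l) {v p : Site}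
    (h1 : p.1 ≤ l * (v.1 + 1)) (h2 : p.2 ≤ l * (v.2 + 1))
    (h3 : p.1 + p.2 = (v.1 + v.2 - d + 2) * l + 1) :
    ∃ w, IsBlockParent d w v ∧ p ∈ block l w := by
  have hl' : (0 : ℤ) < l := by exact_mod_cast hl
  have hp := mem_block_of_add_eq hl (p := p) (n := v.1 + v.2 - d + 1) (by rw [h3]; ring)
  set q := (p.1 - 1) / (l : ℤ)
  obtain ⟨h4, h5, h6⟩ := mem_block_iff.1 hp
  dsimp only at h4 h5 h6
  -- The two upper bounds on the coordinates of `p` leave exactly the `d` values `v.1 - d + 1, …,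
  -- v.1` for `q`, one for each parent.
  have hq1 : q < v.1 + 1 := lt_of_mul_lt_mul_right (a := (l : ℤ)) (by linarith) hl'.le
  have hq2 : v.1 - d < q :=
    lt_of_mul_lt_mul_right (a := (l : ℤ)) (by linarith) hl'.le
  refine ⟨_, ⟨(v.1 - q).toNat, ?_, ?_⟩, hp⟩
  · omega
  · rw [Int.toNat_of_nonneg (by omega)]
    exact Prod.ext (by dsimp only; ring) (by dsimp only; ring)

/-- The parents of a site of the trapezoid `R_v` are in `R_v` or in a block of a parent of `v`. -/
theorem parent_mem_trapezoid_or {d l : ℕ} (hl : 1 ≤ l) {v p e : Site}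
    (he : e = (1, 0) ∨ e = (0, 1)) (hp : p ∈ trapezoid d l v) :
    p - e ∈ trapezoid d l v ∨ ∃ w, IsBlockParent d w v ∧ p - e ∈ block l w := by
  rw [mem_trapezoid] at hp ⊢
  obtain ⟨h1, h2, h3, h4⟩ := hp
  have h5 : (p - e).1 ≤ p.1 ∧ (p - e).2 ≤ p.2 ∧ (p - e).1 + (p - e).2 = p.1 + p.2 - 1 := by
    rcases he with rfl | rfl <;> simp <;> ring
  obtain ⟨h5, h6, h7⟩ := h5
  rcases h3.lt_or_eq with h8 | h8
  · left
    exact ⟨by linarith, by linarith, by linarith, by linarith⟩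
  · right
    exact exists_parent_block hl (by linarith) (by linarith) (by linarith)

theorem diagIndex_lt {d l : ℕ} (hd : 2 ≤ d) (hl : 1 ≤ l) (p : Site) :
    diagIndex d l p < (d - 1) * l := by
  have h : (0 : ℤ) < ((d : ℤ) - 1) * l :=
    mul_pos (by have : (2 : ℤ) ≤ d := by exact_mod_cast hd
                linarith) (by exact_mod_cast hl)
  have h1 := Int.emod_nonneg (p.1 + p.2 - l - 1) h.ne'
  have h2 := Int.emod_lt_of_pos (p.1 + p.2 - l - 1) h
  have h3 : (((d - 1) * l : ℕ) : ℤ) = ((d : ℤ) - 1) * l := by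
    push_cast [Nat.cast_sub (by omega : 1 ≤ d)]; ring
  rw [diagIndex, ← Int.ofNat_lt, h3, Int.toNat_of_nonneg h1]
  exact h2

/-- For a vertex `(h,k)`, `(h + k) l` is a multiple of the period `(d - 1) l`. This lets the
coupling property, assumed for the trapezoid at the origin, be moved to every vertex. -/
theorem diagIndex_add {d l : ℕ} {v : Site} (hv : v ∈ blockVertices d) (p : Site) :
    diagIndex d l (p + (v.1 * l, v.2 * l)) = diagIndex d l p := by
  obtain ⟨c, hc⟩ : ((d : ℤ) - 1) ∣ v.1 + v.2 := hv
  have : (p + (v.1 * l, v.2 * l)).1 + (p + (v.1 * l, v.2 * l)).2 - l - 1 =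
      (p.1 + p.2 - l - 1) + (((d : ℤ) - 1) * l) * c := by
    simp only [Prod.fst_add, Prod.snd_add]
    linear_combination (l : ℤ) * hc
  rw [diagIndex, this, Int.add_mul_emod_self_left, diagIndex]

/-- Trapezoids at different levels of the graph of blocks are disjoint. -/
theorem disjoint_trapezoid {d l : ℕ} (hl : 1 ≤ l) {v w : Site}
    (h : v.1 + v.2 ≤ w.1 + w.2 - ((d : ℤ) - 1)) :
    Disjoint (trapezoid d l v) (trapezoid d l w) := by
  rw [Finset.disjoint_left]
  intro p hv hw
  rw [mem_trapezoid] at hv hw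
  have hl' : (0 : ℤ) < l := by exact_mod_cast hl
  have := mul_le_mul_of_nonneg_right h hl'.le
  linarith [hv.2.2.2, hw.2.2.1]

theorem mem_internalBoundary {S : Finset Site} {p : Site} :
    p ∈ internalBoundary S ↔ p ∈ S ∧ (p - (1, 0) ∉ S ∨ p - (0, 1) ∉ S) := by
  simp [internalBoundary]

/-- Every finite region is contained in one whose internal boundary consists of blocks. -/
theorem exists_boundaryIsBlocks {d l : ℕ} (hd : 2 ≤ d) (hl : 1 ≤ l) (Λ : Finset Site) :
    ∃ Λ' : Finset Site, Λ ⊆ Λ' ∧ BoundaryIsBlocks d l Λ' := by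
  have hl' : (1 : ℤ) ≤ l := by exact_mod_cast hl
  have hd' : (1 : ℤ) ≤ (d : ℤ) - 1 := by
    have : (2 : ℤ) ≤ d := by exact_mod_cast hd
    linarith
  obtain ⟨A, hA0, hA⟩ : ∃ A : ℤ, 0 ≤ A ∧ ∀ p ∈ Λ, |p.1| ≤ A ∧ |p.2| ≤ A := by
    refine ⟨∑ p ∈ Λ, (|p.1| + |p.2|), by positivity, fun p hp => ?_⟩
    have := Finset.single_le_sum (f := fun p : Site => |p.1| + |p.2|)
      (fun _ _ => by positivity) hp
    constructor <;> linarith [abs_nonneg p.1, abs_nonneg p.2]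
  -- The region is the triangle `p.1 ≤ l a`, `p.2 ≤ l a`, `m ≤ p.1 + p.2`. Parents have smaller
  -- coordinates, so its internal boundary is the diagonal `p.1 + p.2 = m`. The value of `m` makes
  -- it a diagonal of blocks with `h + k = -N (d - 1)`, and since the other two sides are at
  -- multiples of `l`, no block is cut.
  set a : ℤ := A
  set N : ℤ := 2 * A + 2
  set m : ℤ := (1 - N * ((d : ℤ) - 1)) * l + 1 with hm
  have hmem : ∀ p : Site, p ∈ (Finset.Icc (m - l * a) (l * a) ×ˢ
      Finset.Icc (m - l * a) (l * a)).filter (fun p => m ≤ p.1 + p.2) ↔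
      p.1 ≤ l * a ∧ p.2 ≤ l * a ∧ m ≤ p.1 + p.2 := by
    intro p
    simp only [Finset.mem_filter, Finset.mem_product, Finset.mem_Icc]
    constructor
    · rintro ⟨⟨⟨_, h1⟩, _, h2⟩, h3⟩
      exact ⟨h1, h2, h3⟩
    · rintro ⟨h1, h2, h3⟩
      exact ⟨⟨⟨by linarith, h1⟩, by linarith, h2⟩, h3⟩
  refine ⟨_, fun p hp => (hmem p).2 ?_, fun p hp => ?_⟩
  · obtain ⟨h1, h2⟩ := hA p hp
    rw [abs_le] at h1 h2
    have h3 : A ≤ l * a := by nlinarith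
    have h4 : N ≤ N * ((d : ℤ) - 1) := by nlinarith
    have h5 : (1 - N * ((d : ℤ) - 1)) * l ≤ (1 - N * ((d : ℤ) - 1)) * 1 :=
      mul_le_mul_of_nonpos_left hl' (by linarith)
    exact ⟨by linarith, by linarith, by linarith⟩
  · rw [mem_internalBoundary, hmem, hmem, hmem] at hp
    simp only [Prod.fst_sub, Prod.snd_sub] at hp
    obtain ⟨⟨h1, h2, h3⟩, h4⟩ := hp
    have h5 : p.1 + p.2 = m := by
      by_contra hne
      have : m + 1 ≤ p.1 + p.2 := by omega
      rcases h4 with h4 | h4 <;> exact h4 ⟨by linarith, by linarith, by linarith⟩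
    have hb := mem_block_of_add_eq hl (p := p) (n := -N * ((d : ℤ) - 1)) (by rw [h5, hm]; ring)
    refine ⟨_, ⟨?_, fun r hr => ?_⟩, hb⟩
    · exact ⟨-N, by dsimp only; ring⟩
    · obtain ⟨h6, h7, h8⟩ := mem_block_iff.1 hr
      obtain ⟨h9, h10, h11⟩ := mem_block_iff.1 hb
      dsimp only at h6 h7 h8 h9 h10 h11
      set q := (p.1 - 1) / (l : ℤ)
      have hr : r.1 + r.2 = m := by rw [h8, hm]; ring
      have hq : q < a := lt_of_mul_lt_mul_right (a := (l : ℤ)) (by linarith) (by linarith)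
      have hq' : (q + 1) * l ≤ a * l := mul_le_mul_of_nonneg_right hq (by linarith)
      have hq2 : -N * ((d : ℤ) - 1) - q < a :=
        lt_of_mul_lt_mul_right (a := (l : ℤ)) (by linarith) (by linarith)
      have hq2' : (-N * ((d : ℤ) - 1) - q + 1) * l ≤ a * l :=
        mul_le_mul_of_nonneg_right hq2 (by linarith)
      rw [mem_internalBoundary, hmem, hmem]
      simp only [Prod.fst_sub, Prod.snd_sub]
      refine ⟨⟨by linarith, by linarith, hr.ge⟩, Or.inl fun h => ?_⟩
      linarith [h.2.2]

/-! ### The recursion over a finite region -/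

/-- Induction along the lattice over a region of finite cardinality. -/
theorem Finset.site_induction {S : Finset Site} {P : Site → Prop}
    (h : ∀ p ∈ S, (∀ q ∈ S, q.1 + q.2 < p.1 + p.2 → P q) → P p) : ∀ p ∈ S, P p := by
  intro p hp
  have hwf : (S : Set Site).WellFoundedOn (InvImage (· < ·) fun p : Site => p.1 + p.2) :=
    have : IsStrictOrder Site (InvImage (· < ·) fun p : Site => p.1 + p.2) :=
      { irrefl := fun a => lt_irrefl (a.1 + a.2)
        trans := fun a b c => lt_trans (a := a.1 + a.2) (b := b.1 + b.2) (c := c.1 + c.2) }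
    S.finite_toSet.wellFoundedOn
  refine hwf.induction (P := P) hp fun q hq ih => h q hq ih

section Recursion

variable {E : Type*}

theorem evolve_of_mem {S : Finset Site} {f : Site → E → E → E} {x : Site → E} {p : Site}
    (hp : p ∈ S) : evolve S f x p =
      f p (evolve S f x (p - (1, 0))) (evolve S f x (p - (0, 1))) := by
  rw [evolve, if_pos hp]

theorem evolve_of_notMem {S : Finset Site} {f : Site → E → E → E} {x : Site → E} {p : Site}
    (hp : p ∉ S) : evolve S f x p = x p := by
  rw [evolve, if_neg hp]

/-- A configuration that obeys the recursion in `S` is the one constructed from its own values off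
`S`. -/
theorem eq_evolve {S : Finset Site} {f : Site → E → E → E} {y : Site → E}
    (h : ∀ p ∈ S, y p = f p (y (p - (1, 0))) (y (p - (0, 1)))) (p : Site) :
    y p = evolve S f y p := by
  by_cases hp : p ∈ S
  · revert p
    refine Finset.site_induction fun p hp ih => ?_
    have key : ∀ e : Site, 0 < e.1 + e.2 → y (p - e) = evolve S f y (p - e) := by
      intro e he
      by_cases hS : p - e ∈ S
      · exact ih _ hS (by simp only [Prod.fst_sub, Prod.snd_sub]; linarith)
      · rw [evolve_of_notMem hS]
    rw [evolve_of_mem hp, h p hp, ← key (1, 0) (by decide), ← key (0, 1) (by decide)]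
  · rw [evolve_of_notMem hp]

theorem evolve_translate {S S' : Finset Site} {f : Site → E → E → E} {x : Site → E} {r : Site}
    (hS : ∀ p, p ∈ S' ↔ p + r ∈ S) (p : Site) :
    evolve S f x (p + r) = evolve S' (fun q => f (q + r)) (fun q => x (q + r)) p := by
  by_cases hp : p ∈ S'
  · revert p
    refine Finset.site_induction fun p hp ih => ?_
    have key : ∀ e : Site, 0 < e.1 + e.2 → evolve S f x (p + r - e) =
        evolve S' (fun q => f (q + r)) (fun q => x (q + r)) (p - e) := by
      intro e he
      rw [add_sub_right_comm]
      by_cases hS' : p - e ∈ S'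
      · exact ih _ hS' (by simp only [Prod.fst_sub, Prod.snd_sub]; linarith)
      · rw [evolve_of_notMem hS', evolve_of_notMem (mt (hS _).2 hS')]
    rw [evolve_of_mem hp, evolve_of_mem ((hS p).1 hp), key (1, 0) (by decide),
      key (0, 1) (by decide)]
  · rw [evolve_of_notMem hp, evolve_of_notMem (mt (hS _).2 hp)]

/-- The constructed field at `p` depends on the part of the region below `p` only. -/
theorem evolve_eq_of_subset {S S' : Finset Site} {f : Site → E → E → E} {x : Site → E}
    (hSS : S ⊆ S') {p : Site} (hp : ∀ q ∈ S', q ≤ p → q ∈ S) :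
    evolve S' f x p = evolve S f x p := by
  by_cases hpS : p ∈ S'
  · revert p
    have : ∀ p ∈ S', (∀ q ∈ S', q ≤ p → q ∈ S) → evolve S' f x p = evolve S f x p := by
      refine Finset.site_induction fun p hp ih hq => ?_
      have key : ∀ e : Site, 0 ≤ e → 0 < e.1 + e.2 →
          evolve S' f x (p - e) = evolve S f x (p - e) := by
        intro e he he'
        by_cases hS' : p - e ∈ S'
        · refine ih _ hS' (by simp only [Prod.fst_sub, Prod.snd_sub]; linarith) fun q hqS hqp => ?_
          exact hq q hqS (hqp.trans (sub_le_self _ he))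
        · rw [evolve_of_notMem hS', evolve_of_notMem (mt (@hSS _) hS')]
      rw [evolve_of_mem hp, evolve_of_mem (hq p hp le_rfl), key (1, 0) (by decide) (by decide),
        key (0, 1) (by decide) (by decide)]
    intro p hp hpS
    exact this p hpS hp
  · rw [evolve_of_notMem hpS, evolve_of_notMem (mt (@hSS _) hpS)]

/-! ### Locality of the block coupling -/

section Locality

variable [MeasurableSpace E] {K : Kernel (E × E) E} {d l : ℕ}
  {s : ℕ → UnitIoo → E → E → E} {ψ : (trapezoid d l 0 → UnitIoo) → Fin 2}
  {Φ : (trapezoid d l 0 → UnitIoo) → block l 0 → E}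

/-- If `W_v = 0` and the region contains `R_v`, then the values on `B_v` are given by `Φ`. -/
theorem IsBlockCoupling.coupledField_eq (hc : IsBlockCoupling K d l s ψ Φ) {v : Site}
    (hv : v ∈ blockVertices d) {S : Finset Site} (hS : trapezoid d l v ⊆ S)
    {u : Site → UnitIoo} (hW : binaryField d l ψ u v = 0) (x : Site → E) {p : Site}
    (hp : p - (v.1 * l, v.2 * l) ∈ block l 0) :
    coupledField d l s S u x p = Φ (onTrapezoid d l u v) ⟨_, hp⟩ := by
  set r : Site := (v.1 * l, v.2 * l)
  -- On `R_v` the field is the one driven by its own values just outside `R_v`; `eq_of_zero` allows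
  -- arbitrary boundary values, so these do no harm.
  have h1 := eq_evolve (S := trapezoid d l v) (f := fun p => s (diagIndex d l p) (u p))
    (y := coupledField d l s S u x) (fun q hq => evolve_of_mem (hS hq)) p
  rw [h1]
  conv_lhs => rw [← sub_add_cancel p r]
  rw [evolve_translate (S' := trapezoid d l 0) (fun q => mem_trapezoid_zero_iff)]
  have h2 := hc.eq_of_zero (fun q => u (q + r)) hW
    (fun q => coupledField d l s S u x (q + r)) ⟨_, hp⟩
  refine Eq.trans ?_ h2
  refine evolve_congr (fun q _ => ?_) _
  dsimp only
  rw [diagIndex_add hv]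

open Classical in
/-- One step of the recursion that defines `Υ^B`. -/
noncomputable def upsilonStep (d l : ℕ) (s : ℕ → UnitIoo → E → E → E)
    (ψ : (trapezoid d l 0 → UnitIoo) → Fin 2)
    (Φ : (trapezoid d l 0 → UnitIoo) → block l 0 → E)
    (B : Finset Site) (u : Site → UnitIoo) (p : Site) (a b : E) : E :=
  let v := blockIndex l p
  if h : p - (v.1 * l, v.2 * l) ∈ block l 0 then
    if v ∈ blockVertices d ∧ trapezoid d l v ⊆ B ∧ binaryField d l ψ u v = 0 then
      Φ (onTrapezoid d l u v) ⟨_, h⟩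
    else s (diagIndex d l p) (u p) a b
  else s (diagIndex d l p) (u p) a b

omit [MeasurableSpace E] in
theorem upsilon_eq_evolve [Nonempty E] (B : Finset Site) (u : Site → UnitIoo) :
    upsilon d l s ψ Φ B u =
      evolve B (upsilonStep d l s ψ Φ B u) fun _ => Classical.arbitrary E := rfl

/-- The coupled field obeys the recursion that defines `Υ^B` in any `B` inside its region. -/
theorem IsBlockCoupling.coupledField_eq_upsilonStep (hc : IsBlockCoupling K d l s ψ Φ)
    {B S : Finset Site} (hBS : B ⊆ S) (u : Site → UnitIoo) (x : Site → E) {p : Site}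
    (hp : p ∈ B) :
    coupledField d l s S u x p = upsilonStep d l s ψ Φ B u p
      (coupledField d l s S u x (p - (1, 0))) (coupledField d l s S u x (p - (0, 1))) := by
  unfold upsilonStep
  dsimp only
  split_ifs with h1 h2
  · exact hc.coupledField_eq h2.1 (h2.2.1.trans hBS) h2.2.2 x h1
  · exact evolve_of_mem (hBS hp)
  · exact evolve_of_mem (hBS hp)

/-- An open path is prolonged backwards by one step; this requires its old first vertex `w` to be
open, but not the new one. Hence the set of needed blocks contains the parents of its open members.
-/
theorem boundaryBlocks_parent_mem_sigmaSet {W : Site → Fin 2} {Λ : Finset Site} {v w : Site}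
    (hw : w ∈ boundaryBlocks d l Λ ∪ sigmaSet d l W Λ) (hW : W w = 1)
    (hv : IsBlockParent d v w) : v ∈ sigmaSet d l W Λ := by
  rcases hw with hw | ⟨n, γ, hn, h0, hb, hγ⟩
  · refine ⟨1, fun k => if k = 0 then v else w, one_pos, by simp, by simpa using hw, ?_⟩
    intro k hk
    obtain rfl : k = 0 := by omega
    simpa using ⟨hv, hW⟩
  · refine ⟨n + 1, fun k => k.casesOn v γ, Nat.succ_pos _, rfl, hb, ?_⟩
    rintro (_ | k) hk
    · change IsBlockParent d v (γ 0) ∧ W (γ 0) = 1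
      rw [h0]
      exact ⟨hv, hW⟩
    · exact hγ k (by omega)

theorem sigmaSet_subset_blockVertices {W : Site → Fin 2} {Λ : Finset Site} :
    sigmaSet d l W Λ ⊆ blockVertices d := by
  rintro v ⟨n, γ, hn, rfl, hb, hγ⟩
  have : ∀ k ≤ n, γ (n - k) ∈ blockVertices d := by
    intro k
    induction k with
    | zero => intro _; exact hb.1
    | succ k ih =>
      intro hk
      have h := (hγ (n - (k + 1)) (by omega)).1
      rw [show n - (k + 1) + 1 = n - k by omega] at h
      exact h.mem_blockVertices (ih (by omega))
  simpa using this n le_rfl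

/-- If the region contains `D⁺(Λ)`, then the field on `Λ` is given by `Υ`, whatever the boundary
conditions are. -/
theorem IsBlockCoupling.coupledField_eq_upsilon [Nonempty E] (hc : IsBlockCoupling K d l s ψ Φ)
    (hd : 2 ≤ d) (hl : 1 ≤ l) {Λ : Finset Site} (hΛ : BoundaryIsBlocks d l Λ)
    {u : Site → UnitIoo} {B S : Finset Site}
    (hB : (B : Set Site) = regionDPlus d l (binaryField d l ψ u) Λ) (hBS : B ⊆ S)
    (x : Site → E) : ∀ p ∈ Λ, coupledField d l s S u x p = upsilon d l s ψ Φ B u p := by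
  set W := binaryField d l ψ u
  set X := coupledField d l s S u x
  set Y := upsilon d l s ψ Φ B u
  set T := boundaryBlocks d l Λ ∪ sigmaSet d l W Λ
  have hX : ∀ p ∈ B, X p = upsilonStep d l s ψ Φ B u p (X (p - (1, 0))) (X (p - (0, 1))) :=
    fun p hp => hc.coupledField_eq_upsilonStep hBS u x hp
  have hY : ∀ p ∈ B, Y p = upsilonStep d l s ψ Φ B u p (Y (p - (1, 0))) (Y (p - (0, 1))) := by
    intro p hp
    simp only [Y, upsilon_eq_evolve]
    exact evolve_of_mem hp
  have hRB : ∀ v ∈ T, trapezoid d l v ⊆ B := by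
    intro v hv p hp
    rw [← Finset.mem_coe, hB]
    exact Or.inr (Set.mem_biUnion hv hp)
  have hΛB : Λ ⊆ B := by
    intro p hp
    rw [← Finset.mem_coe, hB]
    exact Or.inl (Or.inl hp)
  -- When `W v = 0` agreement is claimed on the block only: the other sites of `R_v` may depend on
  -- values outside `B`. When `W v = 1` it holds on all of `R_v`, because the sites feeding `R_v`
  -- from outside lie in parent blocks, which are again in `T`.
  have hblock : ∀ p ∈ B, ∀ v ∈ T, p ∈ trapezoid d l v → (p ∈ block l v ∨ W v = 1) →
      X p = Y p := by
    refine Finset.site_induction fun p hp ih v hv hpv hor => ?_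
    rcases Fin.exists_fin_two.1 ⟨W v, rfl⟩ with h0 | h1
    · have hpb : p ∈ block l v := hor.resolve_right (by rw [h0]; decide)
      rw [hX p hp, hY p hp]
      have hvV : v ∈ blockVertices d :=
        hv.elim (fun h => h.1) fun h => sigmaSet_subset_blockVertices h
      have hi := blockIndex_eq_of_mem hl hpb
      have hpb' := sub_mem_block_zero_iff.2 hpb
      rw [← hi] at hvV hpb' h0 hv
      simp only [upsilonStep]
      rw [dif_pos hpb', if_pos ⟨hvV, hRB _ hv, h0⟩, dif_pos hpb', if_pos ⟨hvV, hRB _ hv, h0⟩]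
    · have key : ∀ e : Site, (e = (1, 0) ∨ e = (0, 1)) → X (p - e) = Y (p - e) := by
        intro e he
        have hlt : (p - e).1 + (p - e).2 < p.1 + p.2 := by
          rcases he with rfl | rfl <;> simp only [Prod.fst_sub, Prod.snd_sub] <;> linarith
        rcases parent_mem_trapezoid_or hl he hpv with h | ⟨w, hw, h⟩
        · exact ih _ (hRB v hv h) hlt v hv h (Or.inr h1)
        · have hwT : w ∈ T := Or.inr (boundaryBlocks_parent_mem_sigmaSet hv h1 hw)
          have h' := block_subset_trapezoid hd hl w h
          exact ih _ (hRB w hwT h') hlt w hwT h' (Or.inl h)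
      rw [hX p hp, hY p hp, key _ (Or.inl rfl), key _ (Or.inr rfl)]
  refine Finset.site_induction fun p hp ih => ?_
  by_cases hpb : p ∈ internalBoundary Λ
  · obtain ⟨v, hv, hpv⟩ := hΛ p hpb
    exact hblock p (hΛB hp) v (Or.inl hv) (block_subset_trapezoid hd hl v hpv) (Or.inl hpv)
  · have h : p - (1, 0) ∈ Λ ∧ p - (0, 1) ∈ Λ := by
      by_contra hcon
      exact hpb (mem_internalBoundary.2 ⟨hp, by tauto⟩)
    rw [hX p (hΛB hp), hY p (hΛB hp), ih _ h.1 (by simp), ih _ h.2 (by simp)]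

end Locality

end Recursion

/-! ### The field of uniform variables and the law of the unilateral field -/

/-- The law of a field of independent uniform variables. -/
noncomputable abbrev uniformField : Measure (Site → UnitIoo) :=
  Measure.infinitePi fun _ => uniformLaw

theorem uniformField_map_translate (r : Site) :
    uniformField.map (fun u p => u (p + r)) = uniformField :=
  Measure.map_infinitePi_infinitePi_of_inj (P := fun _ : Site => uniformLaw) (add_left_injective r)

/-! ### Sequential construction of the unilateral field from uniform variables -/

section Simulation

variable {E : Type*}

/-- The sequential construction of a field, along the list `L` of sites. -/
def simulate (f : Site → UnitIoo → E → E → E) (x : Site → E) (L : List Site)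
    (u : Site → UnitIoo) : Site → E :=
  L.foldl (fun c p => Function.update c p (f p (u p) (c (p - (1, 0))) (c (p - (0, 1))))) x

theorem simulate_concat (f : Site → UnitIoo → E → E → E) (x : Site → E) (L : List Site)
    (p : Site) (u : Site → UnitIoo) :
    simulate f x (L ++ [p]) u = Function.update (simulate f x L u) p (f p (u p)
      (simulate f x L u (p - (1, 0))) (simulate f x L u (p - (0, 1)))) := by
  simp [simulate]

/-- The list is a linear extension of the order on sites: a new site `p` is never below an earlier
one, so adding it to the region affects no value already computed. -/
theorem simulate_eq_evolve (f : Site → UnitIoo → E → E → E) (x : Site → E)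
    {L : List Site} (hL : L.Pairwise fun q p => ¬ p ≤ q) (u : Site → UnitIoo) :
    simulate f x L u = evolve L.toFinset (fun p => f p (u p)) x := by
  induction L using List.reverseRecOn with
  | nil => funext p; rw [evolve_of_notMem (by simp)]; rfl
  | append_singleton L p ih =>
    rw [List.pairwise_append] at hL
    obtain ⟨h1, -, h2⟩ := hL
    have h2 : ∀ q ∈ L, ¬ p ≤ q := fun q hq => h2 q hq p (by simp)
    have hsub : L.toFinset ⊆ (L ++ [p]).toFinset := by
      intro q; simp only [List.mem_toFinset, List.mem_append]; exact Or.inl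
    have key : ∀ q, ¬ p ≤ q → evolve (L ++ [p]).toFinset (fun p => f p (u p)) x q =
        evolve L.toFinset (fun p => f p (u p)) x q := by
      intro q hq
      refine evolve_eq_of_subset hsub fun r hr hrq => ?_
      simp only [List.mem_toFinset, List.mem_append, List.mem_singleton] at hr ⊢
      exact hr.resolve_right fun h => hq (h ▸ hrq)
    rw [simulate_concat, ih h1]
    funext q
    by_cases hqp : q = p
    · subst hqp
      rw [Function.update_self, evolve_of_mem (S := (L ++ [q]).toFinset) (by simp),
        key (q - (1, 0)) (by simp [Prod.le_def]), key (q - (0, 1)) (by simp [Prod.le_def])]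
    · rw [Function.update_of_ne hqp]
      by_cases hpq : p ≤ q
      · have hqL : q ∉ L := fun h => h2 q h hpq
        rw [evolve_of_notMem (by simpa using hqL), evolve_of_notMem (by simp [hqL, hqp])]
      · rw [key q hpq]

variable [MeasurableSpace E]

theorem measurable_simulate {f : Site → UnitIoo → E → E → E}
    (hf : ∀ p, Measurable fun q : UnitIoo × E × E => f p q.1 q.2.1 q.2.2) (x : Site → E)
    (L : List Site) : Measurable (simulate f x L) := by
  induction L using List.reverseRecOn with
  | nil => exact measurable_const
  | append_singleton L p ih =>
    have h : simulate f x (L ++ [p]) = fun u => Function.update (simulate f x L u) p (f p (u p)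
      (simulate f x L u (p - (1, 0))) (simulate f x L u (p - (0, 1)))) :=
      funext fun u => simulate_concat f x L p u
    rw [h]
    refine measurable_update'.comp (ih.prodMk ?_)
    exact (hf p).comp ((measurable_pi_apply p).prodMk
      (((measurable_pi_apply _).comp ih).prodMk ((measurable_pi_apply _).comp ih)))

/-- The construction along `L` is independent of the uniform variables off `L`. -/
theorem indepFun_simulate {f : Site → UnitIoo → E → E → E}
    (hf : ∀ p, Measurable fun q : UnitIoo × E × E => f p q.1 q.2.1 q.2.2) (x : Site → E)
    {L : List Site} {p : Site} (hp : p ∉ L) :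
    IndepFun (simulate f x L) (fun u => u p) uniformField := by
  have hind : iIndepFun (fun (q : Site) (u : Site → UnitIoo) => u q) uniformField :=
    iIndepFun_infinitePi (X := fun _ v => v) fun _ => measurable_id
  have h := hind.indepFun_finset L.toFinset {p} (by simpa using hp) fun q => measurable_pi_apply q
  let v₀ : UnitIoo := ⟨1 / 2, by norm_num, by norm_num⟩
  -- Filling in a constant off `L` exhibits the construction as a measurable function of the
  -- finitely many variables in `L`.
  let ext : (L.toFinset → UnitIoo) → Site → UnitIoo := fun w q =>
    if hq : q ∈ L.toFinset then w ⟨q, hq⟩ else v₀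
  have hext : Measurable ext := by
    refine measurable_pi_lambda _ fun q => ?_
    by_cases hq : q ∈ L.toFinset
    · simp only [ext, dif_pos hq]; exact measurable_pi_apply _
    · simp only [ext, dif_neg hq]; exact measurable_const
  have hsim : ∀ u : Site → UnitIoo, simulate f x L (ext fun q => u q) = simulate f x L u := by
    intro u
    refine List.foldl_ext _ _ _ fun c q hq => ?_
    simp [ext, hq]
  have h2 := h.comp ((measurable_simulate hf x L).comp hext)
    (measurable_pi_apply (⟨p, by simp⟩ : ({p} : Finset Site)))
  have h3 : (simulate f x L ∘ ext) ∘ (fun (u : Site → UnitIoo) (q : L.toFinset) => u q) =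
      simulate f x L := funext hsim
  rw [← h3]
  exact h2

theorem siteKernel_apply (K : Kernel (E × E) E) [IsMarkovKernel K] (p : Site) (c : Site → E) :
    siteKernel K p c =
      (K (c (p - (1, 0)), c (p - (0, 1)))).map fun b => Function.update c p b := by
  rw [siteKernel, Kernel.map_apply _ measurable_update', Kernel.prod_apply, Kernel.id_apply,
    Kernel.comap_apply, Measure.dirac_prod, Measure.map_map measurable_update' (by fun_prop)]
  rfl

/-- The sequential simulation with the kernel `K` along a list without repetitions. -/
theorem foldl_bind_siteKernel (K : Kernel (E × E) E) [IsMarkovKernel K]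
    {f : Site → UnitIoo → E → E → E}
    (hf : ∀ p, Measurable fun q : UnitIoo × E × E => f p q.1 q.2.1 q.2.2)
    (hK : ∀ p x y, uniformLaw.map (fun v => f p v x y) = K (x, y)) (x : Site → E)
    {L : List Site} (hL : L.Nodup) :
    L.foldl (fun μ p => μ.bind (siteKernel K p)) (Measure.dirac x) =
      uniformField.map (simulate f x L) := by
  induction L using List.reverseRecOn with
  | nil =>
    have h : simulate f x [] = fun _ => x := rfl
    rw [h, Measure.map_const]
    simp
  | append_singleton L p ih =>
    rw [List.nodup_append] at hL
    have hp : p ∉ L := fun h => hL.2.2 p h p (by simp) rfl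
    rw [List.foldl_append, ih hL.1, List.foldl_cons, List.foldl_nil]
    let step : (Site → E) × UnitIoo → Site → E := fun q =>
      Function.update q.1 p (f p q.2 (q.1 (p - (1, 0))) (q.1 (p - (0, 1))))
    have hstep : Measurable step := by
      refine measurable_update'.comp (measurable_fst.prodMk ?_)
      exact (hf p).comp ((measurable_snd (α := Site → E)).prodMk
        (((measurable_pi_apply (p - (1, 0))).comp measurable_fst).prodMk
          ((measurable_pi_apply (p - (0, 1))).comp measurable_fst)))
    have hsite : ∀ c, siteKernel K p c = uniformLaw.map fun v => step (c, v) := by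
      intro c
      have h1 : Measurable fun v => f p v (c (p - (1, 0))) (c (p - (0, 1))) :=
        (hf p).comp (measurable_id.prodMk
          (measurable_const (a := (c (p - (1, 0)), c (p - (0, 1))))))
      rw [siteKernel_apply, ← hK p, Measure.map_map (measurable_update c) h1]
      rfl
    have hG := measurable_simulate hf x L
    -- The variable at `p` has not been used before, so the pair of the current configuration and `u
    -- p` has a product law, and updating with it is one application of `siteKernel`.
    have hjoint := (indepFun_iff_map_prod_eq_prod_map_map hG.aemeasurable
      (measurable_pi_apply p).aemeasurable).1 (indepFun_simulate hf x hp)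
    have hev : uniformField.map (fun u => u p) = uniformLaw :=
      Measure.infinitePi_map_eval (fun _ : Site => uniformLaw) p
    rw [hev] at hjoint
    have h2 : simulate f x (L ++ [p]) = step ∘ fun u => (simulate f x L u, u p) :=
      funext fun u => simulate_concat f x L p u
    rw [h2, ← Measure.map_map hstep (hG.prodMk (measurable_pi_apply p)), hjoint]
    have : IsProbabilityMeasure (uniformField.map (simulate f x L)) :=
      Measure.isProbabilityMeasure_map hG.aemeasurable
    ext A hA
    rw [Measure.bind_apply hA (Kernel.aemeasurable _), Measure.map_apply hstep hA,
      Measure.prod_apply (hstep hA)]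
    refine lintegral_congr fun c => ?_
    rw [hsite]
    exact Measure.map_apply (hstep.comp measurable_prodMk_left) hA

end Simulation

theorem boxList_eq (M N : ℕ) : boxList M N =
    (List.range N).flatMap fun j : ℕ => (List.range M).map fun i : ℕ => ((i : ℤ) + 1, (j : ℤ) + 1) := by
  simp [boxList, List.flatMap_map, Function.comp_def, ← List.map_eq_flatMap]

theorem mem_boxList {M N : ℕ} {p : Site} : p ∈ boxList M N ↔ p ∈ box M N := by
  simp only [boxList_eq, List.mem_flatMap, List.mem_range, List.mem_map, box, Finset.mem_product,
    Finset.mem_Icc]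
  constructor
  · rintro ⟨j, hj, i, hi, rfl⟩
    dsimp only
    omega
  · rintro ⟨⟨h1, h2⟩, h3, h4⟩
    exact ⟨(p.2 - 1).toNat, by omega, (p.1 - 1).toNat, by omega,
      Prod.ext (by dsimp only; omega) (by dsimp only; omega)⟩

theorem pairwise_boxList (M N : ℕ) : (boxList M N).Pairwise fun q p => ¬ p ≤ q := by
  rw [boxList_eq, List.pairwise_flatMap]
  constructor
  · intro j _
    rw [List.pairwise_map]
    refine List.pairwise_lt_range.imp ?_
    intro a b hab h
    have := h.1
    dsimp only at this
    omega
  · refine List.pairwise_lt_range.imp ?_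
    intro a b hab q hq p hp h
    simp only [List.mem_map] at hq hp
    obtain ⟨i, -, rfl⟩ := hq
    obtain ⟨i', -, rfl⟩ := hp
    have := h.2
    dsimp only at this
    omega

theorem toFinset_boxList (M N : ℕ) : (boxList M N).toFinset = box M N := by
  ext p; rw [List.mem_toFinset, mem_boxList]

/-! ### Coupled fields as realizations of the unilateral field -/

section Coupling

variable {E : Type*} [MeasurableSpace E] {K : Kernel (E × E) E} {d l : ℕ}
  {s : ℕ → UnitIoo → E → E → E} {ψ : (trapezoid d l 0 → UnitIoo) → Fin 2}
  {Φ : (trapezoid d l 0 → UnitIoo) → block l 0 → E}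

theorem measurable_evolve {S : Finset Site} {f : Site → (Site → UnitIoo) → E → E → E}
    (hf : ∀ p, Measurable fun q : (Site → UnitIoo) × E × E => f p q.1 q.2.1 q.2.2)
    (x : Site → E) (p : Site) : Measurable fun u => evolve S (fun p => f p u) x p := by
  by_cases hp : p ∈ S
  · revert p
    refine Finset.site_induction fun p hp ih => ?_
    have key : ∀ e : Site, 0 < e.1 + e.2 →
        Measurable fun u => evolve S (fun p => f p u) x (p - e) := by
      intro e he
      by_cases hS : p - e ∈ S
      · exact ih _ hS (by simp only [Prod.fst_sub, Prod.snd_sub]; linarith)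
      · simp only [evolve_of_notMem hS]; exact measurable_const
    simp only [evolve_of_mem hp]
    exact (hf p).comp (measurable_id.prodMk ((key (1, 0) (by decide)).prodMk
      (key (0, 1) (by decide))))
  · simp only [evolve_of_notMem hp]; exact measurable_const

theorem IsBlockCoupling.measurable_coupledField (hc : IsBlockCoupling K d l s ψ Φ) (hd : 2 ≤ d)
    (hl : 1 ≤ l) (S : Finset Site) (x : Site → E) (p : Site) :
    Measurable fun u => coupledField d l s S u x p := by
  refine measurable_evolve (f := fun p u => s (diagIndex d l p) (u p)) (fun p => ?_) x p
  have h : Measurable fun q : (Site → UnitIoo) × E × E => (q.1 p, q.2) :=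
    ((measurable_pi_apply p).comp measurable_fst).prodMk measurable_snd
  exact (hc.measurable_s _ (diagIndex_lt hd hl p)).comp h

/-- The unilateral field in a window has the law of the coupled field in a translated box. -/
theorem IsBlockCoupling.boxLaw_map_window [IsMarkovKernel K] (hc : IsBlockCoupling K d l s ψ Φ)
    (hd : 2 ≤ d) (hl : 1 ≤ l) (x : Site → E) (M N : ℕ) (r t : Site) (F : Finset Site) :
    (boxLaw K x M N).map (window F t) = uniformField.map fun u (p : F) =>
      coupledField d l s ((box M N).image (· - r)) u (fun q => x (q + r)) (p + t - r) := by
  -- Every `s_m` realizes `K`, so the index used at a site does not affect the law. Shifting it by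
  -- `r` matches the coupled field in the translated box for arbitrary `r`, not only for
  -- translations that preserve `diagIndex`.
  set f : Site → UnitIoo → E → E → E := fun p => s (diagIndex d l (p - r))
  have hf : ∀ p, Measurable fun q : UnitIoo × E × E => f p q.1 q.2.1 q.2.2 := fun p =>
    hc.measurable_s _ (diagIndex_lt hd hl _)
  have hnodup : (boxList M N).Nodup :=
    (pairwise_boxList M N).imp fun {a b} h hab => h hab.ge
  have hwin : Measurable (window F t : (Site → E) → F → E) :=
    measurable_pi_lambda _ fun p => measurable_pi_apply _
  have htr : Measurable fun (u : Site → UnitIoo) p => u (p + -r) :=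
    measurable_pi_lambda _ fun p => measurable_pi_apply _
  rw [boxLaw, foldl_bind_siteKernel K hf (fun p => hc.map_s _ (diagIndex_lt hd hl _)) x hnodup,
    Measure.map_map hwin (measurable_simulate hf x _)]
  conv_lhs => rw [← uniformField_map_translate (-r)]
  rw [Measure.map_map (hwin.comp (measurable_simulate hf x _)) htr]
  congr 1
  funext u p
  simp only [Function.comp_apply, window]
  rw [simulate_eq_evolve f x (pairwise_boxList M N), toFinset_boxList]
  conv_lhs => rw [← sub_add_cancel ((p : Site) + t) r]
  rw [evolve_translate (S' := (box M N).image (· - r))]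
  · refine evolve_congr (fun q _ => ?_) _
    simp [f]
  · intro q
    simp only [Finset.mem_image]
    constructor
    · rintro ⟨a, ha, rfl⟩; simpa using ha
    · intro h; exact ⟨_, h, by simp⟩

end Coupling

/-! ### Open paths -/

section Paths

variable {d l : ℕ}

/-- The path in the graph of blocks that goes from `w` to its parent of index `c 0`, then to the
parent of that vertex of index `c 1`, and so on. -/
def descend (d : ℕ) (w : Site) (c : ℕ → ℕ) : ℕ → Site
  | 0 => w
  | k + 1 => ((descend d w c k).1 - c k, (descend d w c k).2 + c k - ((d : ℤ) - 1))

/-- The extension of a finite sequence of indices by zeros. -/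
def extendIndex {n : ℕ} (c : Fin n → Fin d) (k : ℕ) : ℕ := if h : k < n then c ⟨k, h⟩ else 0

/-- The level after `k` steps does not depend on the indices chosen; this separates the trapezoids
along a path. -/
theorem descend_add_eq (w : Site) (c : ℕ → ℕ) (k : ℕ) :
    (descend d w c k).1 + (descend d w c k).2 = w.1 + w.2 - k * ((d : ℤ) - 1) := by
  induction k with
  | zero => simp [descend]
  | succ k ih =>
    simp only [descend]
    push_cast
    linear_combination ih

/-- Paths are read backwards from the boundary block and coded by parent indices. The codes form a
countable type, which gives measurability, with `d ^ n` codes of length `n` per boundary block.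
Openness is asked at steps `k < n`, which omits the vertex `v` reached at step `n`. -/
theorem mem_sigmaSet_iff {W : Site → Fin 2} {Λ : Finset Site} {v : Site} :
    v ∈ sigmaSet d l W Λ ↔ ∃ i : boundaryBlocks d l Λ × (n : ℕ) × (Fin n → Fin d),
      0 < i.2.1 ∧ descend d i.1 (extendIndex i.2.2) i.2.1 = v ∧
        ∀ k : Fin i.2.1, W (descend d i.1 (extendIndex i.2.2) k) = 1 := by
  constructor
  · rintro ⟨n, γ, hn, rfl, hb, hγ⟩
    have hstep : ∀ k : Fin n, ∃ i : Fin d, γ (n - (k + 1)) =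
        ((γ (n - k)).1 - (i : ℕ), (γ (n - k)).2 + (i : ℕ) - ((d : ℤ) - 1)) := by
      intro k
      obtain ⟨i, hi, h⟩ := (hγ (n - (k + 1)) (by omega)).1
      rw [show n - (k + 1 : ℕ) + 1 = n - k by omega] at h
      exact ⟨⟨i, hi⟩, h⟩
    choose c hc using hstep
    have hdesc : ∀ k ≤ n, descend d (γ n) (extendIndex c) k = γ (n - k) := by
      intro k
      induction k with
      | zero => intro _; rfl
      | succ k ih =>
        intro hk
        rw [descend, ih (by omega), hc ⟨k, hk⟩, extendIndex, dif_pos (show k < n from hk)]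
    refine ⟨(⟨γ n, hb⟩, ⟨n, c⟩), hn, ?_, fun k => ?_⟩
    · simpa using hdesc n le_rfl
    · change W (descend d (γ n) (extendIndex c) k) = 1
      have hk : (k : ℕ) < n := k.2
      rw [hdesc k hk.le]
      have h := (hγ (n - (k + 1)) (by omega)).2
      rwa [show n - (k + 1 : ℕ) + 1 = n - k by omega] at h
  · rintro ⟨⟨⟨w, hw⟩, n, c⟩, hn, rfl, hW⟩
    refine ⟨n, fun k => descend d w (extendIndex c) (n - k), hn, by simp, by simpa [descend], ?_⟩
    intro k hk
    dsimp only at hn hW ⊢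
    refine ⟨⟨c ⟨n - (k + 1), by omega⟩, Fin.is_lt _, ?_⟩, hW ⟨n - (k + 1), by omega⟩⟩
    have h : n - k = n - (k + 1) + 1 := by omega
    conv_lhs => rw [h, descend, extendIndex, dif_pos (show n - (k + 1) < n by omega)]

variable {ψ : (trapezoid d l 0 → UnitIoo) → Fin 2}

theorem measurable_onTrapezoid (v : Site) :
    Measurable fun u : Site → UnitIoo => onTrapezoid d l u v :=
  measurable_pi_lambda _ fun _ => measurable_pi_apply _

theorem measurableSet_binaryField (hψ : Measurable ψ) (v : Site) (b : Fin 2) :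
    MeasurableSet {u | binaryField d l ψ u v = b} :=
  (hψ.comp (measurable_onTrapezoid v)) (measurableSet_singleton b)

/-- The binary field is independent at vertices with disjoint trapezoids. -/
theorem uniformField_forall_eq_one (hψ : Measurable ψ) {n : ℕ} {v : Fin n → Site}
    (hv : Pairwise fun i j => Disjoint (trapezoid d l (v i)) (trapezoid d l (v j))) :
    uniformField {u | ∀ k, binaryField d l ψ u (v k) = 1} =
      (Measure.pi (fun _ : trapezoid d l 0 => uniformLaw) {w | ψ w = 1}) ^ n := by
  let e : Fin n × trapezoid d l 0 → Site := fun q =>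
    q.2 + ((v q.1).1 * l, (v q.1).2 * l)
  have he : Function.Injective e := by
    rintro ⟨i, r⟩ ⟨j, r'⟩ h
    have h1 : e (i, r) ∈ trapezoid d l (v i) := mem_trapezoid_zero_iff.1 r.2
    have h2 : e (j, r') ∈ trapezoid d l (v j) := mem_trapezoid_zero_iff.1 r'.2
    have hij : i = j := by
      by_contra hne
      exact Finset.disjoint_left.1 (hv hne) h1 (h ▸ h2)
    subst hij
    simp only [e, add_left_inj] at h
    rw [Subtype.ext h]
  have hlaw := Measure.map_infinitePi_infinitePi_of_inj (P := fun _ : Site => uniformLaw) he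
  have hmap : uniformField.map (fun u k => onTrapezoid d l u (v k)) =
      Measure.pi fun _ : Fin n => Measure.pi fun _ : trapezoid d l 0 => uniformLaw := by
    have hcurry := Measure.infinitePi_map_curry
      (fun (_ : Fin n) (_ : trapezoid d l 0) => uniformLaw)
    rw [← Measure.infinitePi_eq_pi, ← Measure.infinitePi_eq_pi, ← hcurry, ← hlaw,
      Measure.map_map (by fun_prop) (by fun_prop)]
    rfl
  have hset : {u : Site → UnitIoo | ∀ k, binaryField d l ψ u (v k) = 1} =
      (fun u k => onTrapezoid d l u (v k)) ⁻¹' (Set.univ.pi fun _ => {w | ψ w = 1}) := by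
    ext u; simp [binaryField]
  have hm : MeasurableSet {w | ψ w = 1} := hψ (measurableSet_singleton 1)
  rw [hset, ← Measure.map_apply
    (measurable_pi_lambda _ fun k => measurable_onTrapezoid (v k))
    (MeasurableSet.univ_pi fun _ => hm), hmap, Measure.pi_pi]
  simp

theorem uniformField_open_path (hd : 2 ≤ d) (hl : 1 ≤ l) (hψ : Measurable ψ) (w : Site)
    (c : ℕ → ℕ) (n : ℕ) :
    uniformField {u | ∀ k : Fin n, binaryField d l ψ u (descend d w c k) = 1} =
      (Measure.pi (fun _ : trapezoid d l 0 => uniformLaw) {w | ψ w = 1}) ^ n := by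
  have key : ∀ i j : Fin n, i < j →
      Disjoint (trapezoid d l (descend d w c j)) (trapezoid d l (descend d w c i)) := by
    intro i j hij
    refine disjoint_trapezoid hl ?_
    rw [descend_add_eq, descend_add_eq]
    have h1 : ((i : ℕ) : ℤ) + 1 ≤ ((j : ℕ) : ℤ) := by exact_mod_cast hij
    have h2 : (0 : ℤ) ≤ (d : ℤ) - 1 := by
      have : (2 : ℤ) ≤ d := by exact_mod_cast hd
      linarith
    nlinarith
  refine uniformField_forall_eq_one hψ fun i j hij => ?_
  rcases lt_or_gt_of_ne hij with h | h
  · exact (key i j h).symm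
  · exact key j i h

end Paths

/-! ### Cardinalities of random sets -/

theorem measurable_toENNReal_encard {Ω ι : Type*} [MeasurableSpace Ω] [Countable ι] {A : Ω → Set ι}
    (hA : ∀ i, MeasurableSet {ω | i ∈ A ω}) :
    Measurable fun ω => ((A ω).encard : ENNReal) := by
  have h : (fun ω => ((A ω).encard : ENNReal)) =
      fun ω => ∑' i, {ω | i ∈ A ω}.indicator (fun _ => (1 : ENNReal)) ω := by
    funext ω
    rw [← ENNReal.tsum_set_one, tsum_subtype (A ω) fun _ => (1 : ENNReal)]
    rfl
  rw [h]
  exact Measurable.tsum fun i => measurable_const.indicator (hA i)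

theorem lintegral_encard {Ω ι : Type*} [MeasurableSpace Ω] [Countable ι] (μ : Measure Ω)
    {A : Ω → Set ι} (hA : ∀ i, MeasurableSet {ω | i ∈ A ω}) :
    ∫⁻ ω, ((A ω).encard : ENNReal) ∂μ = ∑' i, μ {ω | i ∈ A ω} := by
  have h : ∀ ω, ((A ω).encard : ENNReal) =
      ∑' i, {ω | i ∈ A ω}.indicator (fun _ => (1 : ENNReal)) ω := by
    intro ω
    rw [← ENNReal.tsum_set_one, tsum_subtype (A ω) fun _ => (1 : ENNReal)]
    rfl
  simp_rw [h]
  rw [lintegral_tsum fun i => (measurable_const.indicator (hA i)).aemeasurable]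
  exact tsum_congr fun i => by rw [lintegral_indicator_const (hA i), one_mul]

theorem ncard_eq_toReal_encard {ι : Type*} (A : Set ι) :
    (A.ncard : ℝ) = ((A.encard : ENat) : ENNReal).toReal := by
  rw [Set.ncard_def]
  cases A.encard <;> simp

theorem encard_biUnion_le {ι κ : Type*} (T : Set ι) (f : ι → Finset κ) {L : ℕ} (hL : 1 ≤ L)
    (hf : ∀ i, (f i).card ≤ L) : (⋃ i ∈ T, (f i : Set κ)).encard ≤ L * T.encard := by
  classical
  rcases T.finite_or_infinite with hT | hT
  · lift T to Finset ι using hT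
    have h : (⋃ i ∈ (T : Set ι), (f i : Set κ)) = (T.biUnion f : Finset κ) := by
      ext; simp
    rw [h, Set.encard_coe_eq_coe_finsetCard, Set.encard_coe_eq_coe_finsetCard]
    have := Finset.card_biUnion_le_card_mul T f L fun i _ => hf i
    rw [mul_comm]
    exact_mod_cast this
  · rw [hT.encard_eq, ENat.mul_top (by exact_mod_cast (by omega : L ≠ 0))]
    exact le_top

/-! ### Measurability and expected size of the random regions -/

section Regions

variable {d l : ℕ} {ψ : (trapezoid d l 0 → UnitIoo) → Fin 2}

theorem measurable_mem_sigmaSet (hψ : Measurable ψ) (Λ : Finset Site) (v : Site) :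
    Measurable fun u => v ∈ sigmaSet d l (binaryField d l ψ u) Λ := by
  simp only [mem_sigmaSet_iff]
  refine Measurable.exists fun i => measurable_const.and (measurable_const.and ?_)
  exact Measurable.forall fun k => measurableSet_setOfPred.1 (measurableSet_binaryField hψ _ _)

theorem measurableSet_mem_regionD (hψ : Measurable ψ) (Λ : Finset Site) (p : Site) :
    MeasurableSet {u | p ∈ regionD d l (binaryField d l ψ u) Λ} := by
  simp only [regionD, Set.mem_union, Set.mem_iUnion, exists_prop]
  exact measurableSet_setOfPred.2 (measurable_const.or
    (Measurable.exists fun v => (measurable_mem_sigmaSet hψ Λ v).and measurable_const))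

theorem measurableSet_mem_regionDPlus (hψ : Measurable ψ) (Λ : Finset Site) (p : Site) :
    MeasurableSet {u | p ∈ regionDPlus d l (binaryField d l ψ u) Λ} := by
  simp only [regionDPlus, Set.mem_union, Set.mem_iUnion, exists_prop]
  exact measurableSet_setOfPred.2 ((measurableSet_setOfPred.1 (measurableSet_mem_regionD hψ Λ p)).or
    (Measurable.exists fun v =>
      (measurable_const.or (measurable_mem_sigmaSet hψ Λ v)).and measurable_const))

theorem subset_regionD (W : Site → Fin 2) (Λ : Finset Site) :
    (Λ : Set Site) ⊆ regionD d l W Λ := Set.subset_union_left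

theorem regionD_subset_regionDPlus (W : Site → Fin 2) (Λ : Finset Site) :
    regionD d l W Λ ⊆ regionDPlus d l W Λ := Set.subset_union_left

theorem card_trapezoid_le (v : Site) : (trapezoid d l v).card ≤ (trapezoid d l 0).card := by
  refine Finset.card_le_card_of_injOn (fun p => p - (v.1 * (l : ℤ), v.2 * (l : ℤ)))
    (fun p hp => ?_) (sub_left_injective.injOn)
  rw [Finset.mem_coe, mem_trapezoid_zero_iff (v := v), sub_add_cancel]
  exact hp

theorem one_le_card_trapezoid (hd : 2 ≤ d) (hl : 1 ≤ l) : 1 ≤ (trapezoid d l 0).card := by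
  refine Finset.card_pos.2 ⟨(1, (l : ℤ)), block_subset_trapezoid hd hl 0 (mem_block_iff.2 ?_)⟩
  have : (1 : ℤ) ≤ l := by exact_mod_cast hl
  simp only [Prod.fst_zero, Prod.snd_zero]
  exact ⟨by linarith, by linarith, by linarith⟩

/-- Distinct blocks are disjoint, so sending a block to its upper left site injects the boundary
blocks into `∂_I Λ`. -/
theorem encard_boundaryBlocks_le (hl : 1 ≤ l) (Λ : Finset Site) :
    (boundaryBlocks d l Λ).encard ≤ (internalBoundary Λ).card := by
  have hl' : (1 : ℤ) ≤ l := by exact_mod_cast hl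
  have hmem : ∀ v : Site, (v.1 * l + 1, v.2 * l + l) ∈ block l v := fun v =>
    mem_block_iff.2 ⟨le_rfl, by dsimp only; linarith, by dsimp only; ring⟩
  rw [← Set.encard_coe_eq_coe_finsetCard]
  refine Set.encard_le_encard_of_injOn (f := fun v : Site => (v.1 * (l : ℤ) + 1, v.2 * (l : ℤ) + l))
    (fun v hv => hv.2 (hmem v)) fun v _ w _ h => ?_
  have h1 := blockIndex_eq_of_mem hl (hmem v)
  rwa [show ((v.1 * (l : ℤ) + 1, v.2 * (l : ℤ) + l) : Site) = _ from h,
    blockIndex_eq_of_mem hl (hmem w), eq_comm] at h1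

theorem encard_regionDPlus_le (hd : 2 ≤ d) (hl : 1 ≤ l) (W : Site → Fin 2) (Λ : Finset Site) :
    (regionDPlus d l W Λ).encard ≤ Λ.card + (trapezoid d l 0).card *
      ((internalBoundary Λ).card + (sigmaSet d l W Λ).encard) := by
  set T := boundaryBlocks d l Λ ∪ sigmaSet d l W Λ
  have hsub : regionDPlus d l W Λ ⊆ (Λ : Set Site) ∪ ⋃ v ∈ T, (trapezoid d l v : Set Site) := by
    rintro p ((hp | hp) | hp)
    · exact Or.inl hp
    · simp only [Set.mem_iUnion] at hp
      obtain ⟨v, hv, hp⟩ := hp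
      exact Or.inr (Set.mem_biUnion (Or.inr hv) (block_subset_trapezoid hd hl v hp))
    · exact Or.inr hp
  refine (Set.encard_le_encard hsub).trans ((Set.encard_union_le _ _).trans ?_)
  rw [Set.encard_coe_eq_coe_finsetCard]
  gcongr
  refine (encard_biUnion_le T _ (one_le_card_trapezoid hd hl)
    fun v => card_trapezoid_le v).trans ?_
  gcongr
  refine (Set.encard_union_le _ _).trans ?_
  gcongr
  exact encard_boundaryBlocks_le hl Λ

/-- The expected number of vertices reached by open paths. -/
theorem lintegral_encard_sigmaSet_le (hd : 2 ≤ d) (hl : 1 ≤ l) (hψ : Measurable ψ)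
    (Λ : Finset Site) :
    ∫⁻ u, ((sigmaSet d l (binaryField d l ψ u) Λ).encard : ENNReal) ∂uniformField ≤
      (internalBoundary Λ).card * (1 - d * Measure.pi (fun _ : trapezoid d l 0 => uniformLaw)
        {w | ψ w = 1})⁻¹ := by
  set q := Measure.pi (fun _ : trapezoid d l 0 => uniformLaw) {w | ψ w = 1}
  let I := boundaryBlocks d l Λ × (n : ℕ) × (Fin n → Fin d)
  -- A union bound: each vertex of `σ(Λ)` is the end of some open coded path. Keeping the codes with
  -- `n = 0` only increases the count and completes the geometric series.
  let A : (Site → UnitIoo) → Set I := fun u =>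
    {i | ∀ k : Fin i.2.1, binaryField d l ψ u (descend d i.1 (extendIndex i.2.2) k) = 1}
  have hA : ∀ i, MeasurableSet {u | i ∈ A u} := fun i =>
    measurableSet_setOfPred.2
      (Measurable.forall fun k => measurableSet_setOfPred.1 (measurableSet_binaryField hψ _ _))
  calc ∫⁻ u, ((sigmaSet d l (binaryField d l ψ u) Λ).encard : ENNReal) ∂uniformField
      ≤ ∫⁻ u, ((A u).encard : ENNReal) ∂uniformField := by
        refine lintegral_mono fun u => ?_
        have hsub : sigmaSet d l (binaryField d l ψ u) Λ ⊆
            (fun i : I => descend d i.1 (extendIndex i.2.2) i.2.1) '' A u := by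
          intro v hv
          obtain ⟨i, -, h1, h2⟩ := mem_sigmaSet_iff.1 hv
          exact ⟨i, h2, h1⟩
        exact ENat.toENNReal_le.2
          ((Set.encard_le_encard hsub).trans (Set.encard_image_le _ _))
    _ = ∑' i : I, q ^ i.2.1 := by
        rw [lintegral_encard _ hA]
        exact tsum_congr fun i => uniformField_open_path hd hl hψ _ _ _
    _ = (boundaryBlocks d l Λ).encard * (1 - d * q)⁻¹ := by
        rw [ENNReal.tsum_prod (f := fun (_ : boundaryBlocks d l Λ) (i : (n : ℕ) × (Fin n → Fin d)) =>
          q ^ i.1), ENNReal.tsum_set_const, ENNReal.tsum_sigma' (fun i => q ^ i.1),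
          ← ENNReal.tsum_geometric]
        congr 1
        refine tsum_congr fun n => ?_
        rw [tsum_fintype]
        simp [mul_pow]
    _ ≤ _ := by
        gcongr
        exact_mod_cast ENat.toENNReal_le.2 (encard_boundaryBlocks_le hl Λ)

/-- The expected excess of `D⁺(Λ)`, per site of the internal boundary. -/
noncomputable def excessConst (d l : ℕ) (ψ : (trapezoid d l 0 → UnitIoo) → Fin 2) : ENNReal :=
  (trapezoid d l 0).card * (1 + (1 - d *
    Measure.pi (fun _ : trapezoid d l 0 => uniformLaw) {w | ψ w = 1})⁻¹)

theorem lintegral_encard_regionDPlus_le (hd : 2 ≤ d) (hl : 1 ≤ l) (hψ : Measurable ψ)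
    (Λ : Finset Site) :
    ∫⁻ u, ((regionDPlus d l (binaryField d l ψ u) Λ).encard : ENNReal) ∂uniformField ≤
      Λ.card + excessConst d l ψ * (internalBoundary Λ).card := by
  have hσ : Measurable fun u => ((sigmaSet d l (binaryField d l ψ u) Λ).encard : ENNReal) :=
    measurable_toENNReal_encard fun v => measurableSet_setOfPred.2 (measurable_mem_sigmaSet hψ Λ v)
  calc ∫⁻ u, ((regionDPlus d l (binaryField d l ψ u) Λ).encard : ENNReal) ∂uniformField
      ≤ ∫⁻ u, (Λ.card + (trapezoid d l 0).card * ((internalBoundary Λ).card +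
          ((sigmaSet d l (binaryField d l ψ u) Λ).encard : ENNReal))) ∂uniformField := by
        refine lintegral_mono fun u => ?_
        simpa using ENat.toENNReal_le.2 (encard_regionDPlus_le hd hl (binaryField d l ψ u) Λ)
    _ = Λ.card + (trapezoid d l 0).card * ((internalBoundary Λ).card +
          ∫⁻ u, ((sigmaSet d l (binaryField d l ψ u) Λ).encard : ENNReal) ∂uniformField) := by
        rw [lintegral_add_left measurable_const, lintegral_const_mul _ (by fun_prop),
          lintegral_add_left measurable_const]
        simp
    _ ≤ Λ.card + (trapezoid d l 0).card * ((internalBoundary Λ).card +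
          (internalBoundary Λ).card * (1 - d * Measure.pi (fun _ : trapezoid d l 0 => uniformLaw)
            {w | ψ w = 1})⁻¹) := by
        gcongr
        exact lintegral_encard_sigmaSet_le hd hl hψ Λ
    _ = _ := by rw [excessConst]; ring

variable {E : Type*} [MeasurableSpace E] {K : Kernel (E × E) E}
  {s : ℕ → UnitIoo → E → E → E} {Φ : (trapezoid d l 0 → UnitIoo) → block l 0 → E}

/-- The assumption `P(W = 0) > (d - 1)/d` says exactly that `d q < 1`, so the geometric series
converges. -/
theorem IsBlockCoupling.excessConst_ne_top (hc : IsBlockCoupling K d l s ψ Φ) (hd : 2 ≤ d) :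
    excessConst d l ψ ≠ ⊤ := by
  set ν := Measure.pi (fun _ : trapezoid d l 0 => uniformLaw)
  have hm : MeasurableSet {w | ψ w = 0} := hc.measurable_ψ (measurableSet_singleton 0)
  have hcompl : {w | ψ w = 1} = {w | ψ w = 0}ᶜ := by
    ext w
    simp only [Set.mem_compl_iff]
    change ψ w = 1 ↔ ¬ ψ w = 0
    omega
  have hd' : (2 : ℝ) ≤ d := by exact_mod_cast hd
  have h1 : (d : ℝ) * ν.real {w | ψ w = 1} < 1 := by
    have h := hc.prob_zero
    rw [div_lt_iff₀ (by linarith)] at h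
    rw [hcompl, probReal_compl_eq_one_sub hm]
    linarith
  have h2 : (d : ENNReal) * ν {w | ψ w = 1} < 1 := by
    rw [← ENNReal.toReal_lt_toReal (by finiteness) ENNReal.one_ne_top, ENNReal.toReal_mul]
    rw [ENNReal.toReal_natCast, ENNReal.toReal_one]
    exact h1
  refine ENNReal.mul_ne_top (by simp) (ENNReal.add_ne_top.2 ⟨by simp, ?_⟩)
  rw [ENNReal.inv_ne_top]
  exact (tsub_pos_of_lt h2).ne'

theorem IsBlockCoupling.ae_finite_regionDPlus (hc : IsBlockCoupling K d l s ψ Φ) (hd : 2 ≤ d)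
    (hl : 1 ≤ l) (Λ : Finset Site) :
    ∀ᵐ u ∂uniformField, (regionDPlus d l (binaryField d l ψ u) Λ).Finite := by
  have hm : Measurable fun u => ((regionDPlus d l (binaryField d l ψ u) Λ).encard : ENNReal) :=
    measurable_toENNReal_encard (measurableSet_mem_regionDPlus hc.measurable_ψ Λ)
  have h := ae_lt_top hm (ne_top_of_le_ne_top
    (by have := hc.excessConst_ne_top hd; finiteness)
    (lintegral_encard_regionDPlus_le hd hl hc.measurable_ψ Λ))
  filter_upwards [h] with u hu
  rw [← Set.encard_lt_top_iff]
  simpa using hu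

/-- Random regions between `Λ` and `D⁺(Λ)`: the expected excess. -/
theorem IsBlockCoupling.abs_integral_ncard_sub_le (hc : IsBlockCoupling K d l s ψ Φ) (hd : 2 ≤ d)
    (hl : 1 ≤ l) (Λ : Finset Site) {A : (Site → UnitIoo) → Set Site}
    (hA : ∀ p, MeasurableSet {u | p ∈ A u}) (h₁ : ∀ u, (Λ : Set Site) ⊆ A u)
    (h₂ : ∀ u, A u ⊆ regionDPlus d l (binaryField d l ψ u) Λ) :
    Integrable (fun u => ((A u).ncard : ℝ)) uniformField ∧
      |∫ u, ((A u).ncard : ℝ) ∂uniformField - Λ.card| ≤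
        (excessConst d l ψ).toReal * (internalBoundary Λ).card := by
  have hC := hc.excessConst_ne_top hd
  have hm := measurable_toENNReal_encard hA
  have hle : ∫⁻ u, ((A u).encard : ENNReal) ∂uniformField ≤
      Λ.card + excessConst d l ψ * (internalBoundary Λ).card :=
    (lintegral_mono fun u => ENat.toENNReal_le.2 (Set.encard_le_encard (h₂ u))).trans
      (lintegral_encard_regionDPlus_le hd hl hc.measurable_ψ Λ)
  have hfin : ∫⁻ u, ((A u).encard : ENNReal) ∂uniformField ≠ ⊤ :=
    ne_top_of_le_ne_top (by finiteness) hle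
  have hge : (Λ.card : ENNReal) ≤ ∫⁻ u, ((A u).encard : ENNReal) ∂uniformField := by
    have h : ∀ u, (Λ.card : ENNReal) ≤ ((A u).encard : ENNReal) := by
      intro u
      have := Set.encard_le_encard (h₁ u)
      rw [Set.encard_coe_eq_coe_finsetCard] at this
      exact_mod_cast ENat.toENNReal_le.2 this
    calc (Λ.card : ENNReal) = ∫⁻ _, (Λ.card : ENNReal) ∂uniformField := by simp
      _ ≤ _ := lintegral_mono h
  simp_rw [ncard_eq_toReal_encard]
  refine ⟨integrable_toReal_of_lintegral_ne_top hm.aemeasurable hfin, ?_⟩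
  rw [integral_toReal hm.aemeasurable (ae_lt_top hm hfin), abs_of_nonneg]
  · have := ENNReal.toReal_mono (by finiteness) hle
    rw [ENNReal.toReal_add (by finiteness) (by finiteness), ENNReal.toReal_mul] at this
    simp only [ENNReal.toReal_natCast] at this
    linarith
  · have := ENNReal.toReal_mono hfin hge
    rw [ENNReal.toReal_natCast] at this
    linarith

end Regions

/-! ### Total variation distance -/

section TotalVariation

/-- The coupling inequality: the two variables can differ only off `G`, up to a null set. `G` need
not be measurable. -/
theorem tvDist_map_le {Ω α : Type*} [MeasurableSpace Ω] [MeasurableSpace α] (μ : Measure Ω)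
    [IsProbabilityMeasure μ] {Y Z : Ω → α} (hY : Measurable Y) (hZ : Measurable Z) {G : Set Ω}
    (h : ∀ᵐ u ∂μ, u ∈ G → Y u = Z u) : tvDist (μ.map Y) (μ.map Z) ≤ μ Gᶜ := by
  refine iSup₂_le fun A hA => ?_
  have key : ∀ {Y Z : Ω → α}, (∀ᵐ u ∂μ, u ∈ G → Y u = Z u) →
      μ.real (Y ⁻¹' A) ≤ μ.real (Z ⁻¹' A) + μ.real Gᶜ := by
    intro Y Z h
    have hsub : (Y ⁻¹' A : Set Ω) ≤ᵐ[μ] (Z ⁻¹' A ∪ Gᶜ : Set Ω) := by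
      filter_upwards [h] with u hu hA
      by_cases hG : u ∈ G
      · exact Or.inl (show Z u ∈ A from hu hG ▸ hA)
      · exact Or.inr hG
    have := ENNReal.toReal_mono (measure_ne_top μ _) (measure_mono_ae hsub)
    exact this.trans (measureReal_union_le _ _)
  rw [← ofReal_measureReal (μ := μ) (s := Gᶜ)]
  refine ENNReal.ofReal_le_ofReal ?_
  rw [map_measureReal_apply hY hA, map_measureReal_apply hZ hA, abs_le]
  have h1 := key h
  have h2 := key (Y := Z) (Z := Y) (h.mono fun u hu hG => (hu hG).symm)
  constructor <;> linarith

variable {α : Type*} [MeasurableSpace α]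

theorem tvDist_triangle_left (ρ μ ν : Measure α) : tvDist μ ν ≤ tvDist ρ μ + tvDist ρ ν := by
  refine iSup₂_le fun A hA => ?_
  calc ENNReal.ofReal |μ.real A - ν.real A|
      ≤ ENNReal.ofReal (|ρ.real A - μ.real A| + |ρ.real A - ν.real A|) := by
        refine ENNReal.ofReal_le_ofReal ?_
        rw [abs_sub_comm (ρ.real A) (μ.real A)]
        exact abs_sub_le _ _ _
    _ = _ := ENNReal.ofReal_add (abs_nonneg _) (abs_nonneg _)
    _ ≤ _ := add_le_add
        (le_iSup₂ (f := fun A (_ : MeasurableSet A) => ENNReal.ofReal |ρ.real A - μ.real A|) A hA)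
        (le_iSup₂ (f := fun A (_ : MeasurableSet A) => ENNReal.ofReal |ρ.real A - ν.real A|) A hA)

theorem eq_of_tvDist_eq_zero {μ ν : Measure α} [IsFiniteMeasure μ] [IsFiniteMeasure ν]
    (h : tvDist μ ν = 0) : μ = ν := by
  ext A hA
  have h1 : ENNReal.ofReal |μ.real A - ν.real A| ≤ 0 := h ▸
    le_iSup₂ (f := fun A (_ : MeasurableSet A) => ENNReal.ofReal |μ.real A - ν.real A|) A hA
  have h2 : |μ.real A - ν.real A| ≤ 0 := ENNReal.ofReal_eq_zero.1 (le_antisymm h1 bot_le)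
  have h3 : μ.real A = ν.real A := sub_eq_zero.1 (abs_nonpos_iff.1 h2)
  rw [← ofReal_measureReal (μ := μ), ← ofReal_measureReal (μ := ν), h3]

end TotalVariation

/-! ### Laws of fields and their restrictions to boxes -/

section Fields

variable {E : Type*} [MeasurableSpace E]

theorem measurable_window (S : Finset Site) (t : Site) :
    Measurable (window S t : (Site → E) → S → E) :=
  measurable_pi_lambda _ fun _ => measurable_pi_apply _

theorem measurable_translate (e : Site) : Measurable fun (c : Site → E) p => c (p + e) :=
  measurable_pi_lambda _ fun _ => measurable_pi_apply _

/-- Uniqueness of limits: both laws are approached by the same unilateral field, and the triangle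
inequality goes through its law. -/
theorem map_window_eq_of_tendsto {K : Kernel (E × E) E} {π π' : Measure (Site → E)}
    [IsProbabilityMeasure π] [IsProbabilityMeasure π'] {m n : ℕ} {x : Site → E}
    (h : Tendsto (distToField K π m n x) atTop (𝓝 0))
    (h' : Tendsto (distToField K π' m n x) atTop (𝓝 0)) :
    π.map (window (box m n) 0) = π'.map (window (box m n) 0) := by
  have h1 := Measure.isProbabilityMeasure_map (μ := π) (measurable_window (box m n) 0).aemeasurable
  have h2 := Measure.isProbabilityMeasure_map (μ := π') (measurable_window (box m n) 0).aemeasurable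
  refine eq_of_tvDist_eq_zero (le_antisymm ?_ bot_le)
  have hsum := h.add h'
  rw [add_zero] at hsum
  exact ge_of_tendsto hsum (Eventually.of_forall fun t => tvDist_triangle_left _ _ _)

/-- The law of a field is determined by the laws in the translates of boxes. -/
theorem eq_of_map_window_eq {π π' : Measure (Site → E)} [IsProbabilityMeasure π]
    [IsProbabilityMeasure π']
    (h : ∀ (e : Site) (m n : ℕ), (π.map fun c p => c (p + e)).map (window (box m n) 0) =
      (π'.map fun c p => c (p + e)).map (window (box m n) 0)) : π = π' := by
  refine IsProjectiveLimit.unique (P := fun I : Finset Site => π'.map I.restrict) ?_ fun I => rfl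
  intro I
  obtain ⟨z, hz⟩ := I.finite_toSet.bddBelow
  obtain ⟨y, hy⟩ := I.finite_toSet.bddAbove
  -- Boxes start at `(1,1)`, so the lower bound `z` of `I` is moved there.
  set e : Site := z - (1, 1)
  have hI : ∀ p ∈ I, p - e ∈ box (y.1 - e.1).toNat (y.2 - e.2).toNat := by
    intro p hp
    have h1 := (hz hp).1
    have h2 := (hz hp).2
    have h3 := (hy hp).1
    have h4 := (hy hp).2
    simp only [box, Finset.mem_product, Finset.mem_Icc, e, Prod.fst_sub, Prod.snd_sub]
    omega
  let g : (box (y.1 - e.1).toNat (y.2 - e.2).toNat → E) → I → E := fun w p => w ⟨p - e, hI p p.2⟩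
  have hg : Measurable g := measurable_pi_lambda _ fun _ => measurable_pi_apply _
  have hcomp : ∀ π : Measure (Site → E), π.map I.restrict =
      ((π.map fun c p => c (p + e)).map (window (box _ _) 0)).map g := by
    intro π
    rw [Measure.map_map (measurable_window _ _) (measurable_translate e),
      Measure.map_map hg ((measurable_window _ _).comp (measurable_translate e))]
    congr 1
    funext c p
    simp [g, window]
  exact (hcomp π).trans ((congrArg (fun ν => Measure.map g ν) (h e _ _)).trans (hcomp π').symm)

end Fields

/-! ### The equilibrium field -/

section Equilibrium

variable {E : Type*} [MeasurableSpace E] [Nonempty E] {K : Kernel (E × E) E} {d l : ℕ}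
  {s : ℕ → UnitIoo → E → E → E} {ψ : (trapezoid d l 0 → UnitIoo) → Fin 2}
  {Φ : (trapezoid d l 0 → UnitIoo) → block l 0 → E}

theorem IsBlockCoupling.measurable_upsilon (hc : IsBlockCoupling K d l s ψ Φ) (hd : 2 ≤ d)
    (hl : 1 ≤ l) (B : Finset Site) (p : Site) :
    Measurable fun u => upsilon d l s ψ Φ B u p := by
  refine measurable_evolve (f := fun p u => upsilonStep d l s ψ Φ B u p) (fun p => ?_) _ p
  have hs : Measurable fun q : (Site → UnitIoo) × E × E =>
      s (diagIndex d l p) (q.1 p) q.2.1 q.2.2 := by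
    have h : Measurable fun q : (Site → UnitIoo) × E × E => (q.1 p, q.2) :=
      ((measurable_pi_apply p).comp measurable_fst).prodMk measurable_snd
    exact (hc.measurable_s _ (diagIndex_lt hd hl p)).comp h
  unfold upsilonStep
  dsimp only
  split_ifs with h
  · refine Measurable.ite ?_ ?_ hs
    · refine measurableSet_setOfPred.2 (measurable_const.and (measurable_const.and ?_))
      exact measurableSet_setOfPred.1
        (measurable_fst (measurableSet_binaryField hc.measurable_ψ _ _))
    · exact (measurable_pi_apply _).comp
        (hc.measurable_Φ.comp ((measurable_onTrapezoid _).comp measurable_fst))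
  · exact hs

omit [MeasurableSpace E] in
theorem perfectSample_eq_upsilon {Λ B : Finset Site} {u : Site → UnitIoo}
    (hB : (B : Set Site) = regionDPlus d l (binaryField d l ψ u) Λ) (p : Λ) :
    perfectSample d l s ψ Φ Λ u p = upsilon d l s ψ Φ B u p := by
  have h : (regionDPlus d l (binaryField d l ψ u) Λ).Finite := hB ▸ B.finite_toSet
  have hB' : h.toFinset = B := by
    apply Finset.coe_injective
    rw [Set.Finite.coe_toFinset, hB]
  rw [perfectSample, dif_pos h, hB']

open Classical in
-- The random region takes only countably many finite values `B`; on each event `D⁺(Λ) = B` the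
-- sample is the measurable map `Υ^B`.
theorem IsBlockCoupling.measurable_perfectSample (hc : IsBlockCoupling K d l s ψ Φ) (hd : 2 ≤ d)
    (hl : 1 ≤ l) (Λ : Finset Site) : Measurable (perfectSample d l s ψ Φ Λ) := by
  refine measurable_pi_lambda _ fun p => ?_
  let A : Finset Site → Set (Site → UnitIoo) := fun B =>
    {u | (B : Set Site) = regionDPlus d l (binaryField d l ψ u) Λ}
  have hA : ∀ B, MeasurableSet (A B) := by
    intro B
    simp only [A, Set.ext_iff]
    exact measurableSet_setOfPred.2 (Measurable.forall fun p => measurable_const.iff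
      (measurableSet_setOfPred.1 (measurableSet_mem_regionDPlus hc.measurable_ψ Λ p)))
  intro C hC
  have hset : (fun u => perfectSample d l s ψ Φ Λ u p) ⁻¹' C =
      (⋃ B, A B ∩ (fun u => upsilon d l s ψ Φ B u p) ⁻¹' C) ∪
        ((⋃ B, A B)ᶜ ∩ {_u | Classical.arbitrary E ∈ C}) := by
    ext u
    by_cases h : (regionDPlus d l (binaryField d l ψ u) Λ).Finite
    · have hu : u ∈ A h.toFinset := h.coe_toFinset
      have hnot : u ∉ (⋃ B, A B)ᶜ := fun hn => hn (Set.mem_iUnion.2 ⟨_, hu⟩)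
      simp only [Set.mem_union, Set.mem_inter_iff, hnot, false_and, or_false, Set.mem_iUnion,
        Set.mem_preimage]
      constructor
      · intro hp
        exact ⟨_, hu, by rwa [perfectSample_eq_upsilon hu] at hp⟩
      · rintro ⟨B, hB, hp⟩
        rwa [perfectSample_eq_upsilon hB]
    · have hnot : ∀ B, u ∉ A B := fun B hB => h ((show (B : Set Site) = _ from hB) ▸ B.finite_toSet)
      have : perfectSample d l s ψ Φ Λ u p = Classical.arbitrary E := by
        rw [perfectSample, dif_neg h]
      simp [hnot, this]
  rw [hset]
  exact (MeasurableSet.iUnion fun B => (hA B).inter (hc.measurable_upsilon hd hl B p hC)).union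
    ((MeasurableSet.iUnion hA).compl.inter (MeasurableSet.const _))

theorem IsBlockCoupling.coupledField_eq_perfectSample (hc : IsBlockCoupling K d l s ψ Φ)
    (hd : 2 ≤ d) (hl : 1 ≤ l) {Λ : Finset Site} (hΛ : BoundaryIsBlocks d l Λ)
    {u : Site → UnitIoo} (hfin : (regionDPlus d l (binaryField d l ψ u) Λ).Finite)
    {S : Finset Site} (hS : regionDPlus d l (binaryField d l ψ u) Λ ⊆ S) (x : Site → E) (p : Λ) :
    coupledField d l s S u x p = perfectSample d l s ψ Φ Λ u p := by
  rw [perfectSample_eq_upsilon hfin.coe_toFinset]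
  refine hc.coupledField_eq_upsilon hd hl hΛ hfin.coe_toFinset ?_ x p p.2
  rw [← Finset.coe_subset, hfin.coe_toFinset]
  exact hS

/-- The perfect samples in the admissible regions are consistent. -/
theorem IsBlockCoupling.exists_field (hc : IsBlockCoupling K d l s ψ Φ) (hd : 2 ≤ d)
    (hl : 1 ≤ l) : ∃ X : (Site → UnitIoo) → Site → E, Measurable X ∧
      ∀ Λ, BoundaryIsBlocks d l Λ →
        ∀ᵐ u ∂uniformField, ∀ p : Λ, X u p = perfectSample d l s ψ Φ Λ u p := by
  choose cover hsub hcover using fun p : Site => exists_boundaryIsBlocks hd hl {p}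
  have hmem : ∀ p, p ∈ cover p := fun p => hsub p (Finset.mem_singleton_self p)
  refine ⟨fun u p => perfectSample d l s ψ Φ (cover p) u ⟨p, hmem p⟩,
    measurable_pi_lambda _ fun p =>
      (measurable_pi_apply _).comp (hc.measurable_perfectSample hd hl (cover p)), fun Λ hΛ => ?_⟩
  have hall := ae_all_iff.2 fun p : Site => hc.ae_finite_regionDPlus hd hl (cover p)
  filter_upwards [hall, hc.ae_finite_regionDPlus hd hl Λ] with u h1 h2 p
  -- Two perfect samples are compared through one coupled field, on a region large enough to contain
  -- both random regions.
  let S : Finset Site := (h1 p).toFinset ∪ h2.toFinset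
  have hS1 : regionDPlus d l (binaryField d l ψ u) (cover p) ⊆ S := by
    intro q hq; simp [S, hq]
  have hS2 : regionDPlus d l (binaryField d l ψ u) Λ ⊆ S := by
    intro q hq; simp [S, hq]
  let x : Site → E := fun _ => Classical.arbitrary E
  rw [← hc.coupledField_eq_perfectSample hd hl hΛ h2 hS2 x p,
    ← hc.coupledField_eq_perfectSample hd hl (hcover p) (h1 p) hS1 x ⟨p, hmem p⟩]

/-- The quadrant of sites that are right of and above the boundaries of the field, seen from a
window moved by `t`. -/
def quadrant (e : Site) (t : ℕ × ℕ) : Set Site := {p | 1 + e - ((t.1 : ℤ), (t.2 : ℤ)) ≤ p}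

/-- The unilateral field and the translate of `X` are realized with the same uniforms. They agree on
the window unless `D⁺(Λ)` leaves the quadrant, an event in which `x` does not appear. -/
theorem IsBlockCoupling.distToField_le [IsMarkovKernel K] (hc : IsBlockCoupling K d l s ψ Φ)
    (hd : 2 ≤ d) (hl : 1 ≤ l) {X : (Site → UnitIoo) → Site → E} (hX : Measurable X)
    (hXΛ : ∀ Λ, BoundaryIsBlocks d l Λ →
      ∀ᵐ u ∂uniformField, ∀ p : Λ, X u p = perfectSample d l s ψ Φ Λ u p)
    (e : Site) (m n : ℕ) {Λ : Finset Site} (hΛ : BoundaryIsBlocks d l Λ)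
    (hbox : (box m n).image (· + e) ⊆ Λ) (x : Site → E) (t : ℕ × ℕ) :
    distToField K ((uniformField.map X).map fun c p => c (p + e)) m n x t ≤
      uniformField {u | ¬ regionDPlus d l (binaryField d l ψ u) Λ ⊆ quadrant e t} := by
  set τ : Site := ((t.1 : ℤ), (t.2 : ℤ))
  have hwin := measurable_window (E := E) (box m n) 0
  rw [distToField, hc.boxLaw_map_window hd hl x _ _ (τ - e) τ (box m n),
    Measure.map_map hwin (measurable_translate e),
    Measure.map_map (hwin.comp (measurable_translate e)) hX]
  refine tvDist_map_le uniformField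
    (G := {u | regionDPlus d l (binaryField d l ψ u) Λ ⊆ quadrant e t})
    (measurable_pi_lambda _ fun p => hc.measurable_coupledField hd hl _ _ _)
    ((hwin.comp (measurable_translate e)).comp hX) ?_
  filter_upwards [hXΛ Λ hΛ, hc.ae_finite_regionDPlus hd hl Λ] with u hXu hfin hG
  funext p
  have hG : regionDPlus d l (binaryField d l ψ u) Λ ⊆ quadrant e t := hG
  have hpΛ : (p : Site) + e ∈ Λ := hbox (Finset.mem_image_of_mem _ p.2)
  have hp2 := p.2
  simp only [box, Finset.mem_product, Finset.mem_Icc] at hp2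
  set S := (box (t.1 + m) (t.2 + n)).image (· - (τ - e))
  have hmemS : ∀ q, q ∈ S ↔ 1 + e - τ ≤ q ∧ q.1 ≤ m + e.1 ∧ q.2 ≤ n + e.2 := by
    intro q
    simp only [S, Finset.mem_image, box, Finset.mem_product, Finset.mem_Icc, Prod.le_def,
      Prod.fst_sub, Prod.snd_sub, Prod.fst_add, Prod.snd_add, Prod.fst_one, Prod.snd_one, τ]
    push_cast
    constructor
    · rintro ⟨r, ⟨⟨h1, h2⟩, h3, h4⟩, rfl⟩
      simp only [Prod.fst_sub, Prod.snd_sub]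
      refine ⟨⟨?_, ?_⟩, ?_, ?_⟩ <;> linarith
    · rintro ⟨⟨h1, h2⟩, h3, h4⟩
      refine ⟨q + (τ - e), ?_, by simp [τ]⟩
      simp only [Prod.fst_sub, Prod.snd_sub, Prod.fst_add, Prod.snd_add, τ]
      refine ⟨⟨?_, ?_⟩, ?_, ?_⟩ <;> linarith
  -- `D⁺(Λ)` may stick out of the box `S` above or to the right, so `S` is first enlarged. The added
  -- sites do not matter: in the quadrant, those below a site of the window already lie in `S`.
  have h1 := hc.coupledField_eq_perfectSample hd hl hΛ hfin
    (S := S ∪ hfin.toFinset) (by intro q hq; simp [hq]) (fun q => x (q + (τ - e))) ⟨p + e, hpΛ⟩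
  have h2 : coupledField d l s (S ∪ hfin.toFinset) u (fun q => x (q + (τ - e))) (p + e) =
      coupledField d l s S u (fun q => x (q + (τ - e))) (p + e) := by
    refine evolve_eq_of_subset Finset.subset_union_left fun q hq hqp => ?_
    rcases Finset.mem_union.1 hq with hq | hq
    · exact hq
    · refine (hmemS q).2 ⟨hG (hfin.mem_toFinset.1 hq), ?_, ?_⟩
      · have := hqp.1
        simp only [Prod.fst_add] at this
        linarith [hp2.1.2]
      · have := hqp.2
        simp only [Prod.snd_add] at this
        linarith [hp2.2.2]
  have h3 : (p : Site) + τ - (τ - e) = p + e := by abel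
  simp only [Function.comp_apply, window, add_zero]
  rw [h3, ← h2, hXu ⟨p + e, hpΛ⟩]
  exact h1

omit [Nonempty E] in
-- The events decrease as `t` grows, and their intersection is null because a finite region is
-- bounded below.
theorem IsBlockCoupling.tendsto_measure_not_subset_quadrant (hc : IsBlockCoupling K d l s ψ Φ)
    (hd : 2 ≤ d) (hl : 1 ≤ l) (e : Site) (Λ : Finset Site) :
    Tendsto (fun t : ℕ × ℕ =>
      uniformField {u | ¬ regionDPlus d l (binaryField d l ψ u) Λ ⊆ quadrant e t})
      atTop (𝓝 0) := by
  have hm : ∀ t, MeasurableSet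
      {u | ¬ regionDPlus d l (binaryField d l ψ u) Λ ⊆ quadrant e t} := by
    intro t
    simp only [Set.subset_def]
    exact measurableSet_setOfPred.2 (Measurable.not (Measurable.forall fun p => Measurable.imp
      (measurableSet_setOfPred.1 (measurableSet_mem_regionDPlus hc.measurable_ψ Λ p))
      measurable_const))
  have hanti : Antitone fun t : ℕ × ℕ =>
      {u | ¬ regionDPlus d l (binaryField d l ψ u) Λ ⊆ quadrant e t} := by
    intro t t' htt u hu hsub
    refine hu (hsub.trans fun p hp => ?_)
    have h1 : (t.1 : ℤ) ≤ t'.1 := by exact_mod_cast htt.1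
    have h2 : (t.2 : ℤ) ≤ t'.2 := by exact_mod_cast htt.2
    exact le_trans (sub_le_sub_left (show ((t.1 : ℤ), (t.2 : ℤ)) ≤ ((t'.1 : ℤ), (t'.2 : ℤ)) from
      ⟨h1, h2⟩) _) hp
  have h := tendsto_measure_iInter_atTop (μ := uniformField)
    (fun t => (hm t).nullMeasurableSet) hanti ⟨0, measure_ne_top _ _⟩
  have hzero : uniformField (⋂ t : ℕ × ℕ,
      {u | ¬ regionDPlus d l (binaryField d l ψ u) Λ ⊆ quadrant e t}) = 0 := by
    rw [measure_eq_zero_iff_ae_notMem]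
    filter_upwards [hc.ae_finite_regionDPlus hd hl Λ] with u hfin hu
    obtain ⟨z, hz⟩ := hfin.bddBelow
    refine Set.mem_iInter.1 hu ((1 + e.1 - z.1).toNat, (1 + e.2 - z.2).toNat) fun p hp => ?_
    refine le_trans ?_ (hz hp)
    constructor
    · simp only [Prod.fst_sub, Prod.fst_add, Prod.fst_one]; omega
    · simp only [Prod.snd_sub, Prod.snd_add, Prod.snd_one]; omega
  rw [hzero] at h
  exact h

/-- Convergence is needed to every translate of the law of `X`: the indices `diagIndex` are only
periodic, so stationarity is not evident from the construction and is deduced from this. -/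
theorem IsBlockCoupling.tendsto_iSup_distToField [IsMarkovKernel K]
    (hc : IsBlockCoupling K d l s ψ Φ) (hd : 2 ≤ d) (hl : 1 ≤ l)
    {X : (Site → UnitIoo) → Site → E} (hX : Measurable X)
    (hXΛ : ∀ Λ, BoundaryIsBlocks d l Λ →
      ∀ᵐ u ∂uniformField, ∀ p : Λ, X u p = perfectSample d l s ψ Φ Λ u p)
    (e : Site) (m n : ℕ) :
    Tendsto (fun t : ℕ × ℕ => ⨆ x : Site → E,
      distToField K ((uniformField.map X).map fun c p => c (p + e)) m n x t) atTop (𝓝 0) := by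
  obtain ⟨Λ, hsub, hΛ⟩ := exists_boundaryIsBlocks hd hl ((box m n).image (· + e))
  refine tendsto_of_tendsto_of_tendsto_of_le_of_le tendsto_const_nhds
    (hc.tendsto_measure_not_subset_quadrant hd hl e Λ) (fun _ => bot_le) fun t => ?_
  exact iSup_le fun x => hc.distToField_le hd hl hX hXΛ e m n hΛ hsub x t

omit [Nonempty E] in
theorem tendsto_distToField_of_iSup {π : Measure (Site → E)} {m n : ℕ}
    (h : Tendsto (fun t : ℕ × ℕ => ⨆ x : Site → E, distToField K π m n x t) atTop (𝓝 0))
    (x : Site → E) : Tendsto (distToField K π m n x) atTop (𝓝 0) :=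
  tendsto_of_tendsto_of_tendsto_of_le_of_le tendsto_const_nhds h (fun _ => bot_le)
    fun t => le_iSup (fun x => distToField K π m n x t) x

/-- The law of the perfect samples is an equilibrium field, the approach to it is uniform, and it is
the only one. -/
theorem IsBlockCoupling.equilibrium [IsMarkovKernel K]
    (hc : IsBlockCoupling K d l s ψ Φ) (hd : 2 ≤ d) (hl : 1 ≤ l)
    {X : (Site → UnitIoo) → Site → E} (hX : Measurable X)
    (hXΛ : ∀ Λ, BoundaryIsBlocks d l Λ →
      ∀ᵐ u ∂uniformField, ∀ p : Λ, X u p = perfectSample d l s ψ Φ Λ u p) :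
    IsEquilibriumField K (uniformField.map X) ∧
    (∀ m n : ℕ, Tendsto (fun t : ℕ × ℕ => ⨆ x : Site → E,
      distToField K (uniformField.map X) m n x t) atTop (𝓝 0)) ∧
    ∀ π : Measure (Site → E), IsEquilibriumField K π → π = uniformField.map X := by
  set π₀ := uniformField.map X
  have hπ₀ : IsProbabilityMeasure π₀ := Measure.isProbabilityMeasure_map hX.aemeasurable
  have hprob : ∀ (π : Measure (Site → E)) [IsProbabilityMeasure π] (e : Site),
      IsProbabilityMeasure (π.map fun c p => c (p + e)) := fun π _ e =>
    Measure.isProbabilityMeasure_map (measurable_translate e).aemeasurable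
  have hlim := fun (e : Site) (m n : ℕ) => hc.tendsto_iSup_distToField hd hl hX hXΛ e m n
  have hlim0 : ∀ m n : ℕ, Tendsto (fun t : ℕ × ℕ => ⨆ x : Site → E,
      distToField K π₀ m n x t) atTop (𝓝 0) := by
    intro m n
    have h := hlim 0 m n
    simp only [add_zero] at h
    rwa [show (fun (c : Site → E) (p : Site) => c p) = id from rfl, Measure.map_id] at h
  let x₀ : Site → E := fun _ => Classical.arbitrary E
  refine ⟨⟨hπ₀, fun e => ?_, fun x m n => tendsto_distToField_of_iSup (hlim0 m n) x⟩, hlim0,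
    fun π hπ => ?_⟩
  -- The translates by `e'` and by `e' + e` are limits of the same unilateral fields, hence agree in
  -- every box.
  · have := hprob π₀ e
    refine eq_of_map_window_eq fun e' m n => ?_
    have h1 : ((π₀.map fun c p => c (p + e)).map fun c p => c (p + e')) =
        π₀.map fun c p => c (p + (e' + e)) := by
      rw [Measure.map_map (measurable_translate e') (measurable_translate e)]
      congr 1
      funext c p
      simp [add_assoc]
    rw [h1]
    have := hprob π₀ e'
    have := hprob π₀ (e' + e)
    exact map_window_eq_of_tendsto (tendsto_distToField_of_iSup (hlim _ m n) x₀)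
      (tendsto_distToField_of_iSup (hlim _ m n) x₀)
  -- Stationarity of `π` removes the translation on its side; the translate of `π₀` is then a limit
  -- of the same fields as `π`.
  · have := hπ.isProbabilityMeasure
    refine eq_of_map_window_eq fun e m n => ?_
    have := hprob π₀ e
    rw [hπ.stationary e]
    exact map_window_eq_of_tendsto (hπ.tendsto x₀ m n)
      (tendsto_distToField_of_iSup (hlim _ m n) x₀)

end Equilibrium

/-! ### The main theorem -/

theorem mainTheorem2 {E : Type*} [MeasurableSpace E] [StandardBorelSpace E] [Nonempty E]
    (K : Kernel (E × E) E) [IsMarkovKernel K] (d l : ℕ) (hd : 2 ≤ d) (hl : 1 ≤ l)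
    (s : ℕ → UnitIoo → E → E → E)
    (ψ : (trapezoid d l 0 → UnitIoo) → Fin 2)
    (Φ : (trapezoid d l 0 → UnitIoo) → block l 0 → E)
    (hcoupling : IsBlockCoupling K d l s ψ Φ) :
    UniformlyErgodic K ∧
    (∀ Λ : Finset Site, ∃ Λ' : Finset Site, Λ ⊆ Λ' ∧ BoundaryIsBlocks d l Λ') ∧
    ∃ C : ℝ, ∀ (Ω : Type*) [MeasurableSpace Ω] (P : Measure Ω) [IsProbabilityMeasure P]
      (U : Site → Ω → UnitIoo),
      (∀ p, HasLaw (U p) uniformLaw P) → iIndepFun U P →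
      ∀ Λ : Finset Site, BoundaryIsBlocks d l Λ →
        (∀ᵐ ω ∂P, (regionDPlus d l (binaryField d l ψ fun p => U p ω) Λ).Finite) ∧
        (∀ π : Measure (Site → E), IsEquilibriumField K π →
          HasLaw (fun ω => perfectSample d l s ψ Φ Λ fun p => U p ω) (π.map Λ.restrict) P) ∧
        (Integrable
            (fun ω => ((regionD d l (binaryField d l ψ fun p => U p ω) Λ).ncard : ℝ)) P ∧
          |(∫ ω, ((regionD d l (binaryField d l ψ fun p => U p ω) Λ).ncard : ℝ) ∂P) - Λ.card| ≤
            C * (internalBoundary Λ).card) ∧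
        (Integrable
            (fun ω => ((regionDPlus d l (binaryField d l ψ fun p => U p ω) Λ).ncard : ℝ)) P ∧
          |(∫ ω, ((regionDPlus d l (binaryField d l ψ fun p => U p ω) Λ).ncard : ℝ) ∂P)
              - Λ.card| ≤ C * (internalBoundary Λ).card) := by
  obtain ⟨X, hX, hXΛ⟩ := hcoupling.exists_field hd hl
  obtain ⟨heq, hunif, huniq⟩ := hcoupling.equilibrium hd hl hX hXΛ
  refine ⟨⟨_, heq, hunif⟩, exists_boundaryIsBlocks hd hl, (excessConst d l ψ).toReal, ?_⟩
  intro Ω _ P _ U hU hind Λ hΛ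
  have hUm : AEMeasurable (fun ω p => U p ω) P := aemeasurable_pi_iff.2 fun p => (hU p).aemeasurable
  -- The joint law of the given variables is the canonical one, so every statement transfers from
  -- `uniformField` to `P`.
  have hlaw : P.map (fun ω p => U p ω) = uniformField := (hind.hasLaw_infinitePi hU hUm).map_eq
  have hψ := hcoupling.measurable_ψ
  have hcard : ∀ A : (Site → UnitIoo) → Set Site, (∀ p, MeasurableSet {u | p ∈ A u}) →
      (∀ u, (Λ : Set Site) ⊆ A u) →
      (∀ u, A u ⊆ regionDPlus d l (binaryField d l ψ u) Λ) →
      Integrable (fun ω => ((A fun p => U p ω).ncard : ℝ)) P ∧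
        |(∫ ω, ((A fun p => U p ω).ncard : ℝ) ∂P) - Λ.card| ≤
          (excessConst d l ψ).toReal * (internalBoundary Λ).card := by
    intro A hA h₁ h₂
    have hm : Measurable fun u => ((A u).ncard : ℝ) := by
      simp_rw [ncard_eq_toReal_encard]
      exact (measurable_toENNReal_encard hA).ennreal_toReal
    have h := hcoupling.abs_integral_ncard_sub_le hd hl Λ hA h₁ h₂
    rw [← hlaw, integral_map hUm hm.aestronglyMeasurable] at h
    exact ⟨h.1.comp_aemeasurable hUm, h.2⟩
  refine ⟨?_, fun π hπ => ?_, ?_, ?_⟩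
  · have h := hcoupling.ae_finite_regionDPlus hd hl Λ
    rw [← hlaw] at h
    exact ae_of_ae_map hUm h
  · have hps := hcoupling.measurable_perfectSample hd hl Λ
    refine ⟨hps.comp_aemeasurable hUm, ?_⟩
    change P.map (perfectSample d l s ψ Φ Λ ∘ fun ω p => U p ω) = _
    rw [← AEMeasurable.map_map_of_aemeasurable hps.aemeasurable hUm, hlaw, huniq π hπ,
      Measure.map_map (Finset.measurable_restrict Λ) hX]
    refine Measure.map_congr ?_
    filter_upwards [hXΛ Λ hΛ] with u hu
    funext p
    exact (hu p).symm
  · exact hcard (fun u => regionD d l (binaryField d l ψ u) Λ) (measurableSet_mem_regionD hψ Λ)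
      (fun _ => subset_regionD _ _) fun _ => regionD_subset_regionDPlus _ _
  · exact hcard (fun u => regionDPlus d l (binaryField d l ψ u) Λ)
      (measurableSet_mem_regionDPlus hψ Λ)
      (fun _ => (subset_regionD _ _).trans (regionD_subset_regionDPlus _ _)) fun _ => subset_rfl
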